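/- Let $U(\mathfrak{sl}_2)$ be the complex unital associative algebra generated by $E,F,H$ with relations $[H,E]=2E$, $[H,F]=-2F$, $[E,F]=H$, graded by $\mathbb Z$ with $\deg E=1$, $\deg F=-1$, $\deg H=0$; let $U_n$ be its homogeneous subspace of degree $n$ and let $U(\mathfrak{sl}_2)_e=\bigoplus_{n\in\mathbb Z}U_{2n}$, a subalgebra. For $n\in\mathbb N$ let $L_n$ be the $(n+1)$-dimensional $U(\mathfrak{sl}_2)$-module with basis $v_0,\dots,v_n$ and $$Ev_i=(n-i+1)v_{i-1},\qquad Fv_i=(i+1)v_{i+1},\qquad Hv_i=(n-2i)v_i,$$ where $v_{-1}=v_{n+1}=0$. Put $L_n(\theta)=\{v\in L_n : Hv=\theta v\}$. The spaces $L_n^{(0)}=\bigoplus_{i\in\mathbb Z}L_n(n-4i)$ for $n\ge 0$ and $L_n^{(1)}=\bigoplus_{i\in\mathbb Z}L_n(n-4i-2)$ for $n\geq 1$ are $U(\mathfrak{sl}_2)_e$-submodules of $L_n$. Let $D\ge 2$ be an integer, $X=\{0,1\}^D$, and $\partial(x,y)=|\{i : x_i\ne y_i\}|$ for $x,y\in X$.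 Let $X_e=\{x\in X : \sum_i x_i \text{ is even}\}$, the vertex set of the halved cube $\frac12H(D,2)$, in which $x,y$ are adjacent if and only if $\partial(x,y)=2$. Let $\mathbb C^X$ be the complex vector space with basis $X$, and let $\mathbb C^{X_e}$ be its subspace spanned by $X_e$. Define linear endomorphisms of $\mathbb C^X$ by $\mathbf A y=\sum_{\partial(y,z)=1}z$ and, for $x\in X$, $\mathbf A^*(x)y=(D-2\partial(x,y))y$, for all $y\in X$. For $x\in X_e$ the Terwilliger algebra $\mathbf T_e(x)$ of $\frac12H(D,2)$ with respect to $x$ is the (unital) subalgebra of $\mathrm{End}(\mathbb C^{X_e})$ generated by $\mathbf A^2|_{\mathbb C^{X_e}}$ and $\mathbf A^*(x)|_{\mathbb C^{X_e}}$. There is an algebra homomorphism $\rho(x):U(\mathfrak{sl}_2)\to\mathrm{End}(\mathbb C^X)$ with $$E\mapsto\tfrac12\mathbf A-\tfrac14[\mathbf A,\mathbf A^*(x)],\qquad F\mapsto\tfrac12\mathbf A+\tfrac14[\mathbf A,\mathbf A^*(x)],\qquad H\mapsto\mathbf A^*(x),$$ and $u\mapsto\rho(x)(u)|_{\mathbb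 C^{X_e}}$ is a surjective algebra homomorphism $U(\mathfrak{sl}_2)_e\to\mathbf T_e(x)$; through it each $\mathbf T_e(x)$-module is a $U(\mathfrak{sl}_2)_e$-module. Then for every $x\in X_e$ the following hold. (i) Each of the $U(\mathfrak{sl}_2)_e$-modules $$L_{D-2k}^{(0)}\ \ (k \text{ even},\ 0\le k\le\lfloor D/2\rfloor),\qquad L_{D-2k}^{(1)}\ \ (k\text{ odd},\ 1\le k\le\lfloor (D-1)/2\rfloor)$$ arises from a (unique) $\mathbf T_e(x)$-module structure. With these structures they are irreducible and mutually non-isomorphic $\mathbf T_e(x)$-modules, and every irreducible $\mathbf T_e(x)$-module is isomorphic to one of them. (ii) The algebra $\mathbf T_e(x)$ is isomorphic to $$\bigoplus_{\substack{0\le k\le\lfloor D/2\rfloor\\ k\text{ even}}}\mathrm{End}\bigl(\mathbb C^{\lfloor D/2\rfloor-k+1}\bigr)\ \oplus\bigoplus_{\substack{1\le k\le\lfloor (D-1)/2\rfloor\\ k\text{ odd}}}\mathrm{End}\bigl(\mathbb C^{\lfloor (D-1)/2\rfloor-k+1}\bigr).$$ (iii) The dimension of $\mathbf T_e(x)$ is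 $$\binom{\lfloor D/2\rfloor+3}{3}+\binom{\lceil D/2\rceil+1}{3}.$$ -/

import Mathlib

namespace HalvedCube

/-! ### The algebra `U(sl₂)` and its even subalgebra -/

/-- The three generators of `U(sl₂)`. -/
inductive Gen : Type
  | E
  | F
  | H

/-- Free generators, as elements of the free algebra. -/
noncomputable abbrev fr (g : Gen) : FreeAlgebra ℂ Gen := FreeAlgebra.ι ℂ g

/-- The defining relations `[H,E] = 2E`, `[H,F] = -2F`, `[E,F] = H`. -/
inductive Rel : FreeAlgebra ℂ Gen → FreeAlgebra ℂ Gen → Prop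
  | HE : Rel (fr .H * fr .E - fr .E * fr .H) ((2 : ℂ) • fr .E)
  | HF : Rel (fr .H * fr .F - fr .F * fr .H) ((-2 : ℂ) • fr .F)
  | EF : Rel (fr .E * fr .F - fr .F * fr .E) (fr .H)

/-- `U(sl₂)`: the complex algebra generated by `E, F, H` subject to the relations `Rel`. -/
def U : Type := RingQuot Rel

noncomputable instance : Ring U := inferInstanceAs (Ring (RingQuot Rel))
noncomputable instance : Algebra ℂ U := inferInstanceAs (Algebra ℂ (RingQuot Rel))

/-- The generators of `U(sl₂)`. -/
noncomputable def gen (g : Gen) : U := RingQuot.mkAlgHom ℂ Rel (fr g)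

/-- Triples of elements of an algebra satisfying the relations give homomorphisms from `U(sl₂)`. -/
noncomputable def U.lift {R : Type*} [Ring R] [Algebra ℂ R] (f : Gen → R)
    (h1 : f .H * f .E - f .E * f .H = (2 : ℂ) • f .E)
    (h2 : f .H * f .F - f .F * f .H = (-2 : ℂ) • f .F)
    (h3 : f .E * f .F - f .F * f .E = f .H) : U →ₐ[ℂ] R :=
  RingQuot.liftAlgHom ℂ (s := Rel) ⟨FreeAlgebra.lift ℂ f, by
    intro a b hab
    cases hab
    · simpa using h1
    · simpa using h2
    · simpa using h3⟩

theorem U.lift_gen {R : Type*} [Ring R] [Algebra ℂ R] (f : Gen → R) (h1) (h2) (h3) (g : Gen) :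
    U.lift f h1 h2 h3 (gen g) = f g := by
  have := RingQuot.liftAlgHom_mkAlgHom_apply (S := ℂ) (s := Rel) (FreeAlgebra.lift ℂ f)
    (by
      intro a b hab
      cases hab
      · simpa using h1
      · simpa using h2
      · simpa using h3) (fr g)
  exact this.trans (by simp)

theorem gen_HE : gen .H * gen .E - gen .E * gen .H = (2 : ℂ) • gen .E := by
  have := RingQuot.mkAlgHom_rel ℂ Rel.HE
  simp only [map_sub, map_mul, map_smul] at this
  exact this

theorem gen_HF : gen .H * gen .F - gen .F * gen .H = (-2 : ℂ) • gen .F := by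
  have := RingQuot.mkAlgHom_rel ℂ Rel.HF
  simp only [map_sub, map_mul, map_smul] at this
  exact this

theorem gen_EF : gen .E * gen .F - gen .F * gen .E = gen .H := by
  have := RingQuot.mkAlgHom_rel ℂ Rel.EF
  simp only [map_sub, map_mul] at this
  exact this

/-- The degrees of the generators `E, F, H` are `1, -1, 0`. -/
def Gen.deg : Gen → ℤ
  | .E => 1
  | .F => -1
  | .H => 0

/-- The degree of a word in the generators. -/
def wordDeg (l : List Gen) : ℤ := (l.map Gen.deg).sum

/-- The element of `U(sl₂)` represented by a word in the generators. -/
noncomputable def word (l : List Gen) : U := (l.map gen).prod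

/-- The homogeneous subspace `U_n` of the `ℤ`-graded algebra `U(sl₂)`: the image of the space of
homogeneous elements of degree `n` of the free algebra, i.e. the span of all words of degree `n`. -/
noncomputable def Ugr (n : ℤ) : Submodule ℂ U :=
  Submodule.span ℂ {u | ∃ l : List Gen, wordDeg l = n ∧ word l = u}

theorem iSup_Ugr : (⨆ n : ℤ, Ugr (2 * n)) =
    Submodule.span ℂ {u | ∃ l : List Gen, Even (wordDeg l) ∧ word l = u} := by
  apply le_antisymm
  · refine iSup_le fun n => Submodule.span_mono ?_
    rintro _ ⟨l, hl, rfl⟩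
    exact ⟨l, hl ▸ even_two_mul n, rfl⟩
  · refine Submodule.span_le.2 ?_
    rintro _ ⟨l, ⟨m, hm⟩, rfl⟩
    refine (le_iSup (fun n : ℤ => Ugr (2 * n)) m) (Submodule.subset_span ⟨l, ?_, rfl⟩)
    omega

/-- The even subalgebra `U(sl₂)_e`, the direct sum of the `U_{2n}`, `n ∈ ℤ`. -/
noncomputable def Ue : Subalgebra ℂ U where
  carrier := (⨆ n : ℤ, Ugr (2 * n) : Submodule ℂ U)
  add_mem' := fun ha hb => Submodule.add_mem _ ha hb
  algebraMap_mem' := fun r => by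
    rw [iSup_Ugr, Algebra.algebraMap_eq_smul_one]
    exact Submodule.smul_mem _ _ (Submodule.subset_span ⟨[], by simp [wordDeg], by simp [word]⟩)
  mul_mem' := fun {a b} ha hb => by
    rw [iSup_Ugr] at *
    have : a * b ∈ Submodule.span ℂ {u | ∃ l : List Gen, Even (wordDeg l) ∧ word l = u} *
        Submodule.span ℂ {u | ∃ l : List Gen, Even (wordDeg l) ∧ word l = u} :=
      Submodule.mul_mem_mul ha hb
    rw [Submodule.span_mul_span] at this
    refine Submodule.span_mono ?_ this
    rintro _ ⟨_, ⟨l, hl, rfl⟩, _, ⟨m, hm, rfl⟩, rfl⟩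
    exact ⟨l ++ m, by simpa [wordDeg] using hl.add hm, by simp [word]⟩

theorem mem_Ue_iff (u : U) : u ∈ Ue ↔
    u ∈ Submodule.span ℂ {u | ∃ l : List Gen, Even (wordDeg l) ∧ word l = u} := by
  rw [← iSup_Ugr]; rfl

/-! ### The modules `L_n` and their submodules `L_n⁽⁰⁾`, `L_n⁽¹⁾` -/

/-- The space of the `(n+1)`-dimensional `U(sl₂)`-module `L_n`, with basis indexed by `0, …, n`. -/
def L (n : ℕ) : Type := Fin (n + 1) → ℂ

noncomputable instance (n : ℕ) : AddCommGroup (L n) :=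
  inferInstanceAs (AddCommGroup (Fin (n + 1) → ℂ))
noncomputable instance (n : ℕ) : Module ℂ (L n) :=
  inferInstanceAs (Module ℂ (Fin (n + 1) → ℂ))

/-- The basis of `L_n`. -/
noncomputable def L.basis (n : ℕ) : Module.Basis (Fin (n + 1)) ℂ (L n) :=
  Pi.basisFun ℂ (Fin (n + 1))

/-- The basis vectors `v_0, …, v_n` of `L_n`, with the convention `v_i = 0` for `i > n`. -/
noncomputable def L.v (n i : ℕ) : L n :=
  if h : i < n + 1 then L.basis n ⟨i, h⟩ else 0

/-- The linear endomorphism of `L_n` with prescribed values `w i` on the basis vectors `v_i`. -/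
noncomputable def L.onBasis (n : ℕ) (w : ℕ → L n) : Module.End ℂ (L n) :=
  (L.basis n).constr ℂ fun i : Fin (n + 1) => w i

/-- The action of the generators on `L_n`: `E v_i = (n-i+1) v_{i-1}` (and `E v_0 = 0`),
`F v_i = (i+1) v_{i+1}` (and `F v_n = 0`), `H v_i = (n-2i) v_i`. -/
noncomputable def L.act (n : ℕ) : Gen → Module.End ℂ (L n)
  | .E => L.onBasis n fun i => if i = 0 then 0 else ((n : ℂ) - i + 1) • L.v n (i - 1)
  | .F => L.onBasis n fun i => ((i : ℂ) + 1) • L.v n (i + 1)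
  | .H => L.onBasis n fun i => ((n : ℂ) - 2 * i) • L.v n i

theorem L.v_of_gt {n i : ℕ} (h : n < i) : L.v n i = 0 := by
  unfold L.v; rw [dif_neg (by omega)]

theorem L.onBasis_v (n : ℕ) (w : ℕ → L n) (i : ℕ) (hi : i ≤ n) :
    L.onBasis n w (L.v n i) = w i := by
  unfold L.v L.onBasis
  rw [dif_pos (by omega)]
  rw [Module.Basis.constr_basis]

theorem L.ext_v {n : ℕ} {f g : Module.End ℂ (L n)} (h : ∀ i, f (L.v n i) = g (L.v n i)) :
    f = g := by
  refine (L.basis n).ext fun i => ?_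
  have := h i
  unfold L.v at this
  rw [dif_pos i.2] at this
  exact this

theorem L.E_zero (n : ℕ) : L.act n .E (L.v n 0) = 0 := by
  simp [L.act, L.onBasis_v]

theorem L.E_succ (n i : ℕ) : L.act n .E (L.v n (i + 1)) = ((n : ℂ) - i) • L.v n i := by
  rcases lt_trichotomy i n with h | h | h
  · rw [L.act, L.onBasis_v _ _ _ (by omega)]
    rw [if_neg (Nat.succ_ne_zero i), Nat.add_sub_cancel]
    congr 1; push_cast; ring
  · subst h; simp [L.v_of_gt (Nat.lt_succ_self i)]
  · simp [L.v_of_gt h, L.v_of_gt (Nat.lt_succ_of_lt h)]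

theorem L.F_v (n i : ℕ) : L.act n .F (L.v n i) = ((i : ℂ) + 1) • L.v n (i + 1) := by
  rcases le_or_gt i n with h | h
  · rw [L.act, L.onBasis_v _ _ _ h]
  · simp [L.v_of_gt h, L.v_of_gt (Nat.lt_succ_of_lt h)]

theorem L.H_v (n i : ℕ) : L.act n .H (L.v n i) = ((n : ℂ) - 2 * i) • L.v n i := by
  rcases le_or_gt i n with h | h
  · rw [L.act, L.onBasis_v _ _ _ h]
  · simp [L.v_of_gt h]

/-- The homomorphism `U(sl₂) → End(L_n)` defining the module `L_n`. -/
noncomputable def L.rep (n : ℕ) : U →ₐ[ℂ] Module.End ℂ (L n) :=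
  U.lift (L.act n)
    (by
      refine L.ext_v fun i => ?_
      cases i with
      | zero => simp [L.E_zero, L.H_v]
      | succ i =>
        simp only [LinearMap.sub_apply, Module.End.mul_apply, L.E_succ, L.H_v, map_smul, smul_smul,
          ← sub_smul, LinearMap.smul_apply]
        congr 1; push_cast; ring)
    (by
      refine L.ext_v fun i => ?_
      simp only [LinearMap.sub_apply, Module.End.mul_apply, L.F_v, L.H_v, map_smul, smul_smul,
          ← sub_smul, LinearMap.smul_apply]
      congr 1; push_cast; ring)
    (by
      refine L.ext_v fun i => ?_
      cases i with
      | zero => simp [L.E_zero, L.E_succ, L.F_v, L.H_v]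
      | succ i =>
        simp only [LinearMap.sub_apply, Module.End.mul_apply, L.E_succ, L.F_v, L.H_v, map_smul,
          smul_smul, ← sub_smul]
        congr 1; push_cast; ring)

/-- The `U(sl₂)`-module structure of `L_n`. -/
noncomputable instance (n : ℕ) : Module U (L n) :=
  Module.compHom (L n) (L.rep n).toRingHom

theorem L.smul_def (n : ℕ) (u : U) (v : L n) : u • v = L.rep n u v := rfl

instance (n : ℕ) : IsScalarTower ℂ U (L n) where
  smul_assoc a u v := by simp [L.smul_def]

section Weight

variable (V : Type*) [AddCommGroup V] [Module ℂ V] [Module U V] [IsScalarTower ℂ U V]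

/-- `V(θ) = {v ∈ V | H v = θ v}`. -/
noncomputable def wt (θ : ℂ) : Submodule ℂ V where
  carrier := {v | gen .H • v = θ • v}
  zero_mem' := by simp
  add_mem' := fun {a b} ha hb => by
    simp only [Set.mem_ofPred_eq] at *
    rw [smul_add, smul_add, ha, hb]
  smul_mem' := fun c v hv => by
    simp only [Set.mem_ofPred_eq] at *
    rw [← algebraMap_smul U c v, smul_smul, ← Algebra.commutes, mul_smul, hv,
      ← algebraMap_smul U θ v, smul_smul, Algebra.commutes, mul_smul, algebraMap_smul,
      algebraMap_smul]

theorem gen_wt (g : Gen) (θ : ℂ) (v : V) (hv : v ∈ wt V θ) :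
    gen g • v ∈ wt V (θ + 2 * (g.deg : ℂ)) := by
  have hv' : gen .H • v = algebraMap ℂ U θ • v := by rw [algebraMap_smul]; exact hv
  change gen .H • gen g • v = (θ + 2 * (g.deg : ℂ)) • gen g • v
  rw [← algebraMap_smul U (θ + _) (gen g • v), map_add, add_smul, smul_smul (algebraMap ℂ U θ),
    Algebra.commutes, mul_smul, ← hv', smul_smul, smul_smul, smul_smul, ← add_smul]
  congr 1
  cases g
  · have := gen_HE
    rw [sub_eq_iff_eq_add] at this
    rw [this, Algebra.smul_def, add_comm]; simp [Gen.deg]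
  · have := gen_HF
    rw [sub_eq_iff_eq_add] at this
    rw [this, Algebra.smul_def, add_comm]; simp [Gen.deg]
  · simp [Gen.deg]

theorem word_wt (l : List Gen) (θ : ℂ) (v : V) (hv : v ∈ wt V θ) :
    word l • v ∈ wt V (θ + 2 * (wordDeg l : ℂ)) := by
  induction l with
  | nil => simpa [word, wordDeg] using hv
  | cons g l ih =>
    have := gen_wt V g _ _ ih
    rw [smul_smul] at this
    have e : θ + 2 * ((wordDeg (g :: l) : ℤ) : ℂ) =
        θ + 2 * (wordDeg l : ℂ) + 2 * (g.deg : ℂ) := by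
      simp only [wordDeg, List.map_cons, List.sum_cons]; push_cast; ring
    rw [e]
    simpa [word] using this

/-- The `U(sl₂)_e`-submodule `⨁_{i ∈ ℤ} V(θ - 4i)` of a `U(sl₂)`-module `V`. -/
noncomputable def wtSum (θ : ℂ) : Submodule Ue V where
  carrier := (⨆ i : ℤ, wt V (θ - 4 * i) : Submodule ℂ V)
  zero_mem' := Submodule.zero_mem _
  add_mem' := fun ha hb => Submodule.add_mem _ ha hb
  smul_mem' := fun u v hv => by
    obtain ⟨u, hu⟩ := u
    have hu' := (mem_Ue_iff u).1 hu
    change u • v ∈ (⨆ i : ℤ, wt V (θ - 4 * i) : Submodule ℂ V)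
    clear hu
    induction hu' using Submodule.span_induction with
    | zero => rw [zero_smul]; exact Submodule.zero_mem _
    | add a b _ _ ha hb => rw [add_smul]; exact Submodule.add_mem _ ha hb
    | smul c a _ ha => rw [smul_assoc]; exact Submodule.smul_mem _ _ ha
    | mem a ha =>
      obtain ⟨l, ⟨m, hm⟩, rfl⟩ := ha
      have hv' : v ∈ (⨆ i : ℤ, wt V (θ - 4 * i) : Submodule ℂ V) := hv
      induction hv' using Submodule.iSup_induction' with
      | zero => rw [smul_zero]; exact Submodule.zero_mem _
      | add a b _ _ ha hb => rw [smul_add]; exact Submodule.add_mem _ (ha ‹_›) (hb ‹_›)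
      | mem i w hw =>
        have := word_wt V l _ _ hw
        have e : θ - 4 * (i : ℂ) + 2 * (wordDeg l : ℂ) = θ - 4 * ((i - m : ℤ) : ℂ) := by
          rw [hm]; push_cast; ring
        rw [e] at this
        exact Submodule.mem_iSup_of_mem (i - m) this

end Weight

/-- `L_n⁽⁰⁾ = ⨁_{i ∈ ℤ} L_n(n - 4i)`. -/
noncomputable def L0 (n : ℕ) : Submodule Ue (L n) := wtSum (L n) (n : ℂ)

/-- `L_n⁽¹⁾ = ⨁_{i ∈ ℤ} L_n(n - 4i - 2)`. -/
noncomputable def L1 (n : ℕ) : Submodule Ue (L n) := wtSum (L n) ((n : ℂ) - 2)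

/-! ### The hypercube and its halved graph -/

/-- The vertex set of the hypercube `H(D,2)`: all `0`-`1` sequences of length `D`. The distance
of the hypercube is the Hamming distance `hammingDist`. -/
abbrev X (D : ℕ) : Type := Fin D → Fin 2

/-- The vertex set of the halved cube: the `0`-`1` sequences with even sum of coordinates. -/
def Xe (D : ℕ) : Set (X D) := {x | Even (∑ i, (x i : ℕ))}

/-- The complex vector space `ℂ^X` with basis `X`. -/
def CX (D : ℕ) : Type := X D → ℂ

noncomputable instance (D : ℕ) : AddCommGroup (CX D) := inferInstanceAs (AddCommGroup (X D → ℂ))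
noncomputable instance (D : ℕ) : Module ℂ (CX D) := inferInstanceAs (Module ℂ (X D → ℂ))

/-- The basis `X` of `ℂ^X`. -/
noncomputable def vert (D : ℕ) : Module.Basis (X D) ℂ (CX D) := Pi.basisFun ℂ (X D)

/-- The adjacency operator of `H(D,2)` on the free vector space on `X D`. -/
noncomputable def adj (D : ℕ) : Module.End ℂ (CX D) :=
  (vert D).constr ℂ fun x : X D =>
    ∑ y : X D with hammingDist x y = 1, vert D y

/-- The dual adjacency operator of `H(D,2)` with respect to `x`:
`y ↦ (D - 2 ∂(x,y)) y`. -/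
noncomputable def dualAdj {D : ℕ} (x : X D) : Module.End ℂ (CX D) :=
  (vert D).constr ℂ fun y : X D =>
    ((D : ℂ) - 2 * (hammingDist x y : ℂ)) • vert D y

/-- Reversing the `i`-th coordinate. -/
def flip {D : ℕ} (i : Fin D) (y : X D) : X D := Function.update y i (1 - y i)

theorem flip_flip {D : ℕ} (i : Fin D) (y : X D) : flip i (flip i y) = y := by
  unfold flip; ext j; by_cases h : j = i
  · subst h; simp
  · simp [h]

/-- The operator induced by reversing the `i`-th coordinate. -/
noncomputable def sig {D : ℕ} (i : Fin D) : Module.End ℂ (CX D) :=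
  (vert D).constr ℂ fun y : X D => vert D (flip i y)

/-- The diagonal operator with entry `1` or `-1` according to whether `x_i = y_i`. -/
noncomputable def tau {D : ℕ} (x : X D) (i : Fin D) : Module.End ℂ (CX D) :=
  (vert D).constr ℂ fun y : X D =>
    (if x i = y i then (1 : ℂ) else -1) • vert D y

theorem End_ext {D : ℕ} {f g : Module.End ℂ (CX D)}
    (h : ∀ y, f (vert D y) = g (vert D y)) : f = g :=
  (vert D).ext h

theorem sig_single {D : ℕ} (i : Fin D) (y : X D) :
    sig i (vert D y) = vert D (flip i y) := by
  simp [sig]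

theorem tau_single {D : ℕ} (x : X D) (i : Fin D) (y : X D) :
    tau x i (vert D y) =
      (if x i = y i then (1 : ℂ) else -1) • vert D y := by
  simp only [tau, Module.Basis.constr_basis]

theorem fin2_ne_iff (a b : Fin 2) : a ≠ b ↔ b = 1 - a := by
  revert a b; decide

theorem flip_inj {D : ℕ} (y : X D) {i j : Fin D} (h : flip i y = flip j y) : i = j := by
  by_contra hij
  have := congrFun h i
  unfold flip at this
  rw [Function.update_self, Function.update_of_ne hij] at this
  exact (fin2_ne_iff (y i) (y i)).2 this.symm rfl

theorem hamming_one {D : ℕ} (y z : X D) :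
    hammingDist y z = 1 ↔ ∃ i, flip i y = z := by
  unfold hammingDist
  rw [Finset.card_eq_one]
  constructor
  · rintro ⟨i, hi⟩
    refine ⟨i, ?_⟩
    ext j
    have hj : j ∈ (Finset.univ.filter fun k => y k ≠ z k) ↔ j ∈ ({i} : Finset (Fin D)) := by
      rw [hi]
    simp only [Finset.mem_filter, Finset.mem_univ, true_and, Finset.mem_singleton] at hj
    unfold flip
    by_cases h : j = i
    · have := hj.2 h
      rw [fin2_ne_iff] at this
      subst h; simp [this]
    · have : y j = z j := by by_contra hne; exact h (hj.1 hne)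
      simp [h, this]
  · rintro ⟨i, rfl⟩
    refine ⟨i, ?_⟩
    ext j
    simp only [Finset.mem_filter, Finset.mem_univ, true_and, Finset.mem_singleton]
    unfold flip
    by_cases h : j = i
    · subst h; simpa using (fin2_ne_iff (y j) (1 - y j)).2 rfl
    · simp [h]

theorem adj_single {D : ℕ} (y : X D) :
    adj D (vert D y) = ∑ i : Fin D, vert D (flip i y) := by
  simp only [adj, Module.Basis.constr_basis]
  symm
  refine Finset.sum_bij (fun i _ => flip i y) ?_ ?_ ?_ ?_
  · intro i _
    simp only [Finset.mem_filter, Finset.mem_univ, true_and]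
    exact (hamming_one _ _).2 ⟨i, rfl⟩
  · intro i _ j _ h; exact flip_inj y h
  · intro z hz
    simp only [Finset.mem_filter, Finset.mem_univ, true_and] at hz
    obtain ⟨i, hi⟩ := (hamming_one _ _).1 hz
    exact ⟨i, Finset.mem_univ _, hi⟩
  · intro i _; rfl

theorem adj_eq (D : ℕ) : adj D = ∑ i : Fin D, sig i := by
  refine End_ext fun y => ?_
  simp [adj_single, LinearMap.sum_apply, sig_single]

theorem dualAdj_eq {D : ℕ} (x : X D) : dualAdj x = ∑ i : Fin D, tau x i := by
  refine End_ext fun y => ?_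
  simp only [dualAdj, LinearMap.sum_apply, tau_single, Module.Basis.constr_basis,
    ← Finset.sum_smul]
  congr 1
  have h : ∀ i, (if x i = y i then (1 : ℂ) else -1) = 1 - 2 * (if x i ≠ y i then 1 else 0) := by
    intro i; by_cases h : x i = y i <;> simp [h]; norm_num
  simp only [h, Finset.sum_sub_distrib, ← Finset.mul_sum, Finset.sum_boole, hammingDist]
  simp

theorem sig_sq {D : ℕ} (i : Fin D) : sig i * sig i = 1 := by
  refine End_ext fun y => ?_
  simp [Module.End.mul_apply, sig_single, flip_flip]

theorem sig_tau_self {D : ℕ} (x : X D) (i : Fin D) : tau x i * sig i = -(sig i * tau x i) := by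
  refine End_ext fun y => ?_
  simp only [Module.End.mul_apply, sig_single, tau_single, LinearMap.neg_apply, map_smul]
  rw [← neg_smul]
  congr 1
  have h : flip i y i = 1 - y i := by simp [flip]
  rw [h]
  generalize x i = a
  generalize y i = b
  fin_cases a <;> fin_cases b <;> simp

theorem sig_tau_ne {D : ℕ} (x : X D) {i j : Fin D} (hij : i ≠ j) :
    tau x i * sig j = sig j * tau x i := by
  refine End_ext fun y => ?_
  simp only [Module.End.mul_apply, sig_single, tau_single, map_smul]
  have h : flip j y i = y i := by simp [flip, hij]
  rw [h]

theorem sig_comm {D : ℕ} (i j : Fin D) : sig i * sig j = sig j * sig i := by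
  refine End_ext fun y => ?_
  simp only [Module.End.mul_apply, sig_single]
  congr 1
  by_cases h : i = j
  · rw [h]
  · ext k; unfold flip
    by_cases hki : k = i
    · subst hki; simp [h]
    · by_cases hkj : k = j
      · subst hkj; simp [hki]
      · simp [hki, hkj]

theorem tau_comm {D : ℕ} (x : X D) (i j : Fin D) : tau x i * tau x j = tau x j * tau x i := by
  refine End_ext fun y => ?_
  simp only [Module.End.mul_apply, tau_single, map_smul, smul_smul]
  rw [mul_comm]

theorem comm_sum {R : Type*} [Ring R] {D : ℕ} (a b c : Fin D → R)
    (hd : ∀ i, a i * b i - b i * a i = c i)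
    (ho : ∀ i j, i ≠ j → a i * b j = b j * a i) :
    (∑ i, a i) * (∑ i, b i) - (∑ i, b i) * (∑ i, a i) = ∑ i, c i := by
  rw [Finset.sum_mul_sum, Finset.sum_mul_sum, Finset.sum_comm (s := Finset.univ) (t := Finset.univ)
    (f := fun i j => b i * a j), ← Finset.sum_sub_distrib]
  refine Finset.sum_congr rfl fun i _ => ?_
  rw [← Finset.sum_sub_distrib, ← hd i]
  refine Finset.sum_eq_single_of_mem i (Finset.mem_univ i) fun j _ hj => ?_
  rw [ho i j hj.symm, sub_self]

theorem tau_sq {D : ℕ} (x : X D) (i : Fin D) : tau x i * tau x i = 1 := by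
  refine End_ext fun y => ?_
  simp only [Module.End.mul_apply, tau_single, map_smul, smul_smul]
  by_cases h : x i = y i <;> simp [h]

theorem comm1 {R : Type*} [Ring R] [Algebra ℂ R] {D : ℕ} (s t : Fin D → R)
    (hst : ∀ i, t i * s i = -(s i * t i)) (hne : ∀ i j, i ≠ j → t i * s j = s j * t i) :
    (∑ i, s i) * (∑ i, t i) - (∑ i, t i) * (∑ i, s i) = ∑ i, (2 : ℂ) • (s i * t i) := by
  refine comm_sum _ _ _ (fun i => ?_) (fun i j h => (hne j i h.symm).symm)
  rw [hst]; module

theorem comm2 {R : Type*} [Ring R] [Algebra ℂ R] {D : ℕ} (s t : Fin D → R)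
    (hst : ∀ i, t i * s i = -(s i * t i)) (hne : ∀ i j, i ≠ j → t i * s j = s j * t i)
    (hs : ∀ i, s i * s i = 1) (hc : ∀ i j, s i * s j = s j * s i) :
    (∑ i, s i) * ((∑ i, s i) * (∑ i, t i) - (∑ i, t i) * (∑ i, s i)) -
      ((∑ i, s i) * (∑ i, t i) - (∑ i, t i) * (∑ i, s i)) * (∑ i, s i) =
      (4 : ℂ) • ∑ i, t i := by
  rw [comm1 s t hst hne, Finset.smul_sum]
  refine comm_sum _ _ _ (fun i => ?_) (fun i j h => ?_)
  · simp only [mul_smul_comm, smul_mul_assoc]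
    rw [mul_assoc, hst, mul_neg, ← mul_assoc, hs, one_mul]; module
  · simp only [mul_smul_comm, smul_mul_assoc]
    rw [← mul_assoc, hc i j, mul_assoc, mul_assoc, hne j i h.symm]

theorem comm3 {R : Type*} [Ring R] [Algebra ℂ R] {D : ℕ} (s t : Fin D → R)
    (hst : ∀ i, t i * s i = -(s i * t i)) (hne : ∀ i j, i ≠ j → t i * s j = s j * t i)
    (ht : ∀ i, t i * t i = 1) (hc : ∀ i j, t i * t j = t j * t i) :
    (∑ i, t i) * ((∑ i, s i) * (∑ i, t i) - (∑ i, t i) * (∑ i, s i)) -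
      ((∑ i, s i) * (∑ i, t i) - (∑ i, t i) * (∑ i, s i)) * (∑ i, t i) =
      (-4 : ℂ) • ∑ i, s i := by
  rw [comm1 s t hst hne, Finset.smul_sum]
  refine comm_sum _ _ _ (fun i => ?_) (fun i j h => ?_)
  · simp only [mul_smul_comm, smul_mul_assoc]
    rw [← mul_assoc, hst, neg_mul, mul_assoc, ht, mul_one]; module
  · simp only [mul_smul_comm, smul_mul_assoc]
    rw [← mul_assoc, hne i j h, mul_assoc, mul_assoc, hc]

theorem adj_comm_comm {D : ℕ} (x : X D) :
    adj D * (adj D * dualAdj x - dualAdj x * adj D) -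
      (adj D * dualAdj x - dualAdj x * adj D) * adj D = (4 : ℂ) • dualAdj x := by
  rw [adj_eq, dualAdj_eq]
  exact comm2 sig (tau x) (sig_tau_self x) (fun i j h => sig_tau_ne x h) sig_sq sig_comm

theorem dualAdj_comm_comm {D : ℕ} (x : X D) :
    dualAdj x * (adj D * dualAdj x - dualAdj x * adj D) -
      (adj D * dualAdj x - dualAdj x * adj D) * dualAdj x = (-4 : ℂ) • adj D := by
  rw [adj_eq, dualAdj_eq]
  exact comm3 sig (tau x) (sig_tau_self x) (fun i j h => sig_tau_ne x h) (tau_sq x) (tau_comm x)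

theorem relE {R : Type*} [Ring R] [Algebra ℂ R] (A S : R)
    (h : S * (A * S - S * A) - (A * S - S * A) * S = (-4 : ℂ) • A) :
    S * ((2⁻¹ : ℂ) • A - (4⁻¹ : ℂ) • (A * S - S * A)) -
      ((2⁻¹ : ℂ) • A - (4⁻¹ : ℂ) • (A * S - S * A)) * S =
      (2 : ℂ) • ((2⁻¹ : ℂ) • A - (4⁻¹ : ℂ) • (A * S - S * A)) := by
  calc _ = -((2⁻¹ : ℂ) • (A * S - S * A)) -
      (4⁻¹ : ℂ) • (S * (A * S - S * A) - (A * S - S * A) * S) := by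
        simp only [mul_sub, sub_mul, mul_smul_comm, smul_mul_assoc]; module
    _ = _ := by rw [h]; module

theorem relF {R : Type*} [Ring R] [Algebra ℂ R] (A S : R)
    (h : S * (A * S - S * A) - (A * S - S * A) * S = (-4 : ℂ) • A) :
    S * ((2⁻¹ : ℂ) • A + (4⁻¹ : ℂ) • (A * S - S * A)) -
      ((2⁻¹ : ℂ) • A + (4⁻¹ : ℂ) • (A * S - S * A)) * S =
      (-2 : ℂ) • ((2⁻¹ : ℂ) • A + (4⁻¹ : ℂ) • (A * S - S * A)) := by
  calc _ = -((2⁻¹ : ℂ) • (A * S - S * A)) +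
      (4⁻¹ : ℂ) • (S * (A * S - S * A) - (A * S - S * A) * S) := by
        simp only [mul_sub, sub_mul, mul_add, add_mul, mul_smul_comm, smul_mul_assoc]; module
    _ = _ := by rw [h]; module

theorem relEF {R : Type*} [Ring R] [Algebra ℂ R] (A S : R)
    (h : A * (A * S - S * A) - (A * S - S * A) * A = (4 : ℂ) • S) :
    ((2⁻¹ : ℂ) • A - (4⁻¹ : ℂ) • (A * S - S * A)) *
      ((2⁻¹ : ℂ) • A + (4⁻¹ : ℂ) • (A * S - S * A)) -
      ((2⁻¹ : ℂ) • A + (4⁻¹ : ℂ) • (A * S - S * A)) *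
      ((2⁻¹ : ℂ) • A - (4⁻¹ : ℂ) • (A * S - S * A)) = S := by
  generalize A * S - S * A = C at *
  calc _ = (4⁻¹ : ℂ) • (A * C - C * A) := by
        simp only [mul_sub, sub_mul, mul_add, add_mul, mul_smul_comm, smul_mul_assoc]; module
    _ = _ := by rw [h]; module

/-- For elements `A, S` of an algebra, the assignment `E ↦ A/2 - [A,S]/4`, `F ↦ A/2 + [A,S]/4`,
`H ↦ S`. -/
noncomputable def rhoGen {R : Type*} [Ring R] [Algebra ℂ R] (A S : R) : Gen → R
  | .E => (2⁻¹ : ℂ) • A - (4⁻¹ : ℂ) • (A * S - S * A)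
  | .F => (2⁻¹ : ℂ) • A + (4⁻¹ : ℂ) • (A * S - S * A)
  | .H => S

/-- The homomorphism from `U(sl₂)` defined by elements `A, S` with `[S,[A,S]] = -4A` and
`[A,[A,S]] = 4S` through `rhoGen`. -/
noncomputable def U.ofPair {R : Type*} [Ring R] [Algebra ℂ R] (A S : R)
    (h1 : S * (A * S - S * A) - (A * S - S * A) * S = (-4 : ℂ) • A)
    (h2 : A * (A * S - S * A) - (A * S - S * A) * A = (4 : ℂ) • S) : U →ₐ[ℂ] R :=
  U.lift (rhoGen A S) (relE A S h1) (relF A S h1) (relEF A S h2)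

theorem U.ofPair_gen {R : Type*} [Ring R] [Algebra ℂ R] (A S : R) (h1) (h2) (g : Gen) :
    U.ofPair A S h1 h2 (gen g) = rhoGen A S g :=
  U.lift_gen _ _ _ _ g

/-- The algebra homomorphism `ρ(x)` from `U(sl₂)` to `End(ℂ^X)` with
`E ↦ A/2 - [A,A*]/4`, `F ↦ A/2 + [A,A*]/4`, `H ↦ A*`, where `A` is the adjacency operator and
`A*` the dual adjacency operator with respect to `x`. -/
noncomputable def rho {D : ℕ} (x : X D) : U →ₐ[ℂ] Module.End ℂ (CX D) :=
  U.ofPair (adj D) (dualAdj x) (dualAdj_comm_comm x) (adj_comm_comm x)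

theorem rho_gen {D : ℕ} (x : X D) (g : Gen) :
    rho x (gen g) = rhoGen (adj D) (dualAdj x) g :=
  U.ofPair_gen _ _ _ _ g

/-! ### The Terwilliger algebra of the halved cube -/

/-- The subspace of `ℂ^X` spanned by a set of vertices. -/
noncomputable def supp {D : ℕ} (s : Set (X D)) : Submodule ℂ (CX D) :=
  Submodule.span ℂ (vert D '' s)

/-- The subspace `ℂ^{X_e}` of `ℂ^X` spanned by the vertices of the halved cube. -/
noncomputable def CXe (D : ℕ) : Submodule ℂ (CX D) := supp (Xe D)

/-- The subspace of `ℂ^X` spanned by the remaining vertices. -/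
noncomputable def CXo (D : ℕ) : Submodule ℂ (CX D) := supp (Xe D)ᶜ

theorem map_supported {D : ℕ} (f : Module.End ℂ (CX D)) (s t : Set (X D))
    (h : ∀ y ∈ s, f (vert D y) ∈ supp t) : ∀ v ∈ supp s, f v ∈ supp t := by
  intro v hv
  unfold supp at hv
  induction hv using Submodule.span_induction with
  | zero => rw [map_zero]; exact Submodule.zero_mem _
  | add a b _ _ ha hb => rw [map_add]; exact Submodule.add_mem _ ha hb
  | smul c a _ ha => rw [map_smul]; exact Submodule.smul_mem _ _ ha
  | mem a ha => obtain ⟨y, hy, rfl⟩ := ha; exact h y hy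

theorem single_mem_supp {D : ℕ} {s : Set (X D)} {y : X D} (hy : y ∈ s) : vert D y ∈ supp s :=
  Submodule.subset_span ⟨y, hy, rfl⟩

theorem flip_mem {D : ℕ} (i : Fin D) (y : X D) : flip i y ∈ Xe D ↔ y ∉ Xe D := by
  unfold Xe
  simp only [Set.mem_ofPred_eq]
  rw [← Finset.add_sum_erase _ (fun j => (flip i y j : ℕ)) (Finset.mem_univ i),
    ← Finset.add_sum_erase _ (fun j => (y j : ℕ)) (Finset.mem_univ i)]
  have h1 : ∑ j ∈ Finset.univ.erase i, (flip i y j : ℕ) =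
      ∑ j ∈ Finset.univ.erase i, (y j : ℕ) := by
    refine Finset.sum_congr rfl fun j hj => ?_
    simp [flip, Finset.ne_of_mem_erase hj]
  have h2 : flip i y i = 1 - y i := by simp [flip]
  rw [h1, h2, Nat.even_add, Nat.even_add]
  generalize y i = b
  fin_cases b <;> simp

theorem adj_mem_odd {D : ℕ} : ∀ v ∈ CXe D, adj D v ∈ CXo D := by
  refine map_supported _ _ _ fun y hy => ?_
  rw [adj_single]
  refine Submodule.sum_mem _ fun i _ => single_mem_supp ?_
  exact fun h => (flip_mem i y).1 h hy

theorem adj_mem_even {D : ℕ} : ∀ v ∈ CXo D, adj D v ∈ CXe D := by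
  refine map_supported _ _ _ fun y hy => ?_
  rw [adj_single]
  exact Submodule.sum_mem _ fun i _ => single_mem_supp ((flip_mem i y).2 hy)

theorem dualAdj_mem {D : ℕ} (x : X D) (s : Set (X D)) :
    ∀ v ∈ supp s, dualAdj x v ∈ supp s := by
  refine map_supported _ _ _ fun y hy => ?_
  simp only [dualAdj, Module.Basis.constr_basis]
  exact Submodule.smul_mem _ _ (single_mem_supp hy)

theorem adjSq_mem {D : ℕ} : ∀ v ∈ CXe D, (adj D ^ 2) v ∈ CXe D := by
  intro v hv
  rw [pow_two]
  exact adj_mem_even _ (adj_mem_odd _ hv)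

/-- The restriction of the square of the adjacency operator `A` of `H(D,2)` to `ℂ^{X_e}`; the
adjacency operator of the halved cube is `(A² - D)/2` on this space. -/
noncomputable def adjSqE (D : ℕ) : Module.End ℂ (CXe D) := (adj D ^ 2).restrict adjSq_mem

/-- The restriction of the dual adjacency operator of `H(D,2)` to `ℂ^{X_e}`. -/
noncomputable def dualAdjE {D : ℕ} (x : X D) : Module.End ℂ (CXe D) :=
  (dualAdj x).restrict (dualAdj_mem x (Xe D))

/-- The Terwilliger algebra of the halved cube with respect to `x`: the subalgebra of
`End(ℂ^{X_e})` generated by the restrictions of `A²` and `A*(x)`. -/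
noncomputable def Te {D : ℕ} (x : X D) : Subalgebra ℂ (Module.End ℂ (CXe D)) :=
  Algebra.adjoin ℂ {adjSqE D, dualAdjE x}

theorem sum_relations {R : Type*} [Ring R] [Algebra ℂ R] (S : Subalgebra ℂ R) (e f h : R)
    (he : h * e - e * h = (2 : ℂ) • e) (hf : h * f - f * h = (-2 : ℂ) • f)
    (hef : e * f - f * e = h) (hh : h ∈ S) (hq : (e + f) * (e + f) ∈ S) :
    e * e ∈ S ∧ e * f ∈ S ∧ f * e ∈ S ∧ f * f ∈ S := by
  have he' : h * e = e * h + (2 : ℂ) • e := by rw [← he]; abel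
  have hf' : h * f = f * h + (-2 : ℂ) • f := by rw [← hf]; abel
  have hee : h * (e * e) = e * e * h + (4 : ℂ) • (e * e) := by
    rw [← mul_assoc, he', add_mul, mul_assoc, he', mul_add, smul_mul_assoc, mul_smul_comm,
      mul_assoc]
    module
  have hff : h * (f * f) = f * f * h + (-4 : ℂ) • (f * f) := by
    rw [← mul_assoc, hf', add_mul, mul_assoc, hf', mul_add, smul_mul_assoc, mul_smul_comm,
      mul_assoc]
    module
  have hmix : h * (e * f) = e * f * h := by
    rw [← mul_assoc, he', add_mul, mul_assoc, hf', mul_add, smul_mul_assoc, mul_smul_comm,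
      mul_assoc]
    module
  have hmix' : h * (f * e) = f * e * h := by
    rw [← mul_assoc, hf', add_mul, mul_assoc, he', mul_add, smul_mul_assoc, mul_smul_comm,
      mul_assoc]
    module
  have hQ : (e + f) * (e + f) = e * e + e * f + f * e + f * f := by noncomm_ring
  have c1 : h * ((e + f) * (e + f)) - (e + f) * (e + f) * h =
      (4 : ℂ) • (e * e) - (4 : ℂ) • (f * f) := by
    rw [hQ]
    simp only [mul_add, add_mul, hee, hff, hmix, hmix']
    module
  have m1 : e * e - f * f ∈ S := by
    have := S.smul_mem (S.sub_mem (S.mul_mem hh hq) (S.mul_mem hq hh)) (4⁻¹ : ℂ)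
    rw [c1] at this
    convert this using 1
    module
  have c2 : h * (e * e - f * f) - (e * e - f * f) * h = (4 : ℂ) • (e * e) + (4 : ℂ) • (f * f) := by
    simp only [mul_sub, sub_mul, hee, hff]
    module
  have m2 : e * e + f * f ∈ S := by
    have := S.smul_mem (S.sub_mem (S.mul_mem hh m1) (S.mul_mem m1 hh)) (4⁻¹ : ℂ)
    rw [c2] at this
    convert this using 1
    module
  have mee : e * e ∈ S := by
    have := S.smul_mem (S.add_mem m2 m1) (2⁻¹ : ℂ)
    convert this using 1
    module
  have mff : f * f ∈ S := by
    have := S.smul_mem (S.sub_mem m2 m1) (2⁻¹ : ℂ)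
    convert this using 1
    module
  have m3 : e * f + f * e ∈ S := by
    have := S.sub_mem (S.sub_mem hq mee) mff
    convert this using 1
    rw [hQ]; abel
  rw [← hef] at hh
  refine ⟨mee, ?_, ?_, mff⟩
  · have := S.smul_mem (S.add_mem m3 hh) (2⁻¹ : ℂ)
    convert this using 1
    module
  · have := S.smul_mem (S.sub_mem m3 hh) (2⁻¹ : ℂ)
    convert this using 1
    module

theorem word_cons (g : Gen) (l : List Gen) : word (g :: l) = gen g * word l := by
  simp [word]

theorem wordDeg_cons (g : Gen) (l : List Gen) : wordDeg (g :: l) = g.deg + wordDeg l := by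
  simp [wordDeg]

/-- A subalgebra of `U(sl₂)` containing `H` and `(E+F)²` contains all words of even degree. -/
theorem Ue_le (S : Subalgebra ℂ U) (hh : gen .H ∈ S)
    (hq : (gen .E + gen .F) * (gen .E + gen .F) ∈ S) : Ue ≤ S := by
  obtain ⟨mee, mef, mfe, mff⟩ := sum_relations S _ _ _ gen_HE gen_HF gen_EF hh hq
  have key : ∀ l : List Gen, (Even (wordDeg l) → word l ∈ S) ∧
      (¬ Even (wordDeg l) → gen .E * word l ∈ S ∧ gen .F * word l ∈ S) := by
    intro l
    induction l with
    | nil => exact ⟨fun _ => by simp [word, S.one_mem], fun h => absurd (by simp [wordDeg]) h⟩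
    | cons g l ih =>
      rw [word_cons, wordDeg_cons]
      cases g with
      | E =>
        have hp : Even (Gen.deg .E + wordDeg l) ↔ ¬ Even (wordDeg l) := by
          simp [Gen.deg, Int.even_add]
        rw [hp, not_not]
        refine ⟨fun h => (ih.2 h).1, fun h => ?_⟩
        rw [← mul_assoc, ← mul_assoc]
        exact ⟨S.mul_mem mee (ih.1 h), S.mul_mem mfe (ih.1 h)⟩
      | F =>
        have hp : Even (Gen.deg .F + wordDeg l) ↔ ¬ Even (wordDeg l) := by
          simp [Gen.deg, Int.even_add]
        rw [hp, not_not]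
        refine ⟨fun h => (ih.2 h).2, fun h => ?_⟩
        rw [← mul_assoc, ← mul_assoc]
        exact ⟨S.mul_mem mef (ih.1 h), S.mul_mem mff (ih.1 h)⟩
      | H =>
        have hp : Even (Gen.deg .H + wordDeg l) ↔ Even (wordDeg l) := by simp [Gen.deg]
        rw [hp]
        refine ⟨fun h => S.mul_mem hh (ih.1 h), fun h => ?_⟩
        obtain ⟨hE, hF⟩ := ih.2 h
        constructor
        · have e : gen .E * (gen .H * word l) =
              gen .H * (gen .E * word l) - (2 : ℂ) • (gen .E * word l) := by
            rw [← mul_assoc, ← mul_assoc, ← smul_mul_assoc, ← gen_HE, ← sub_mul]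
            congr 1; abel
          rw [e]
          exact S.sub_mem (S.mul_mem hh hE) (S.smul_mem hE _)
        · have e : gen .F * (gen .H * word l) =
              gen .H * (gen .F * word l) - (-2 : ℂ) • (gen .F * word l) := by
            rw [← mul_assoc, ← mul_assoc, ← smul_mul_assoc, ← gen_HF, ← sub_mul]
            congr 1; abel
          rw [e]
          exact S.sub_mem (S.mul_mem hh hF) (S.smul_mem hF _)
  intro u hu
  rw [mem_Ue_iff] at hu
  refine (Submodule.span_le (p := Subalgebra.toSubmodule S)).2 ?_ hu
  rintro _ ⟨l, hl, rfl⟩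
  exact (key l).1 hl

theorem rho_H {D : ℕ} (x : X D) : rho x (gen .H) = dualAdj x := rho_gen x .H

theorem rho_EF {D : ℕ} (x : X D) :
    rho x ((gen .E + gen .F) * (gen .E + gen .F)) = adj D ^ 2 := by
  have h : ∀ {R : Type} [Ring R] [Algebra ℂ R] (A S : R),
      rhoGen A S .E + rhoGen A S .F = A := by
    intro R _ _ A S
    simp only [rhoGen]
    module
  rw [map_mul, map_add, rho_gen, rho_gen, h, pow_two]

/-- The elements of `U(sl₂)` whose action on `ℂ^X` preserves `ℂ^{X_e}`. -/
noncomputable def stab {D : ℕ} (x : X D) : Subalgebra ℂ U where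
  carrier := {u | ∀ v ∈ CXe D, rho x u v ∈ CXe D}
  mul_mem' := fun {a b} ha hb v hv => by
    rw [map_mul]; exact ha _ (hb _ hv)
  add_mem' := fun {a b} ha hb v hv => by
    rw [map_add]; exact Submodule.add_mem _ (ha _ hv) (hb _ hv)
  algebraMap_mem' := fun r v hv => by
    rw [AlgHom.commutes]; exact Submodule.smul_mem _ r hv

theorem rho_mem {D : ℕ} (x : X D) (u : U) (hu : u ∈ Ue) : ∀ v ∈ CXe D, rho x u v ∈ CXe D := by
  refine Ue_le (stab x) ?_ ?_ hu
  · intro v hv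
    rw [rho_H]; exact dualAdj_mem x _ v hv
  · intro v hv
    rw [rho_EF]; exact adjSq_mem v hv

/-- The homomorphism `U(sl₂)_e → End(ℂ^{X_e})`, `u ↦ ρ(x)(u)|_{ℂ^{X_e}}`. -/
noncomputable def rhoE {D : ℕ} (x : X D) : Ue →ₐ[ℂ] Module.End ℂ (CXe D) where
  toFun u := (rho x u.1).restrict (rho_mem x u.1 u.2)
  map_one' := by ext1 v; apply Subtype.ext; simp
  map_mul' a b := by ext1 v; apply Subtype.ext; simp
  map_zero' := by ext1 v; apply Subtype.ext; simp
  map_add' a b := by ext1 v; apply Subtype.ext; simp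
  commutes' r := by ext1 v; apply Subtype.ext; simp

theorem rhoE_mem {D : ℕ} (x : X D) (u : Ue) : rhoE x u ∈ Te x := by
  have hle : Ue ≤ ((Te x).comap (rhoE x)).map Ue.val := by
    apply Ue_le
    · have hH : gen .H ∈ Ue := (mem_Ue_iff _).2 (Submodule.subset_span
        ⟨[.H], by simp [wordDeg, Gen.deg], by simp [word]⟩)
      refine ⟨⟨gen .H, hH⟩, ?_, rfl⟩
      change rhoE x ⟨gen .H, hH⟩ ∈ Te x
      have e : rhoE x ⟨gen .H, hH⟩ = dualAdjE x := by
        ext1 v; apply Subtype.ext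
        change rho x (gen .H) v = dualAdj x v
        rw [rho_H]
      rw [e]
      exact Algebra.subset_adjoin (by simp)
    · have hw : ∀ a b : Gen, Even (a.deg + b.deg) → gen a * gen b ∈ Ue := fun a b h =>
        (mem_Ue_iff _).2 (Submodule.subset_span
          ⟨[a, b], by simpa [wordDeg] using h, by simp [word]⟩)
      have hQ : (gen .E + gen .F) * (gen .E + gen .F) ∈ Ue := by
        rw [mul_add, add_mul, add_mul]
        refine Ue.add_mem (Ue.add_mem ?_ ?_) (Ue.add_mem ?_ ?_) <;>
          exact hw _ _ (by simp [Gen.deg])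
      refine ⟨⟨_, hQ⟩, ?_, rfl⟩
      change rhoE x ⟨_, hQ⟩ ∈ Te x
      have e : rhoE x ⟨_, hQ⟩ = adjSqE D := by
        ext1 v; apply Subtype.ext
        change rho x _ v = (adj D ^ 2) v
        rw [rho_EF]
      rw [e]
      exact Algebra.subset_adjoin (by simp)
  obtain ⟨w, hw, hwu⟩ := hle u.2
  have : w = u := Subtype.ext hwu
  subst this
  exact hw

/-- The homomorphism `U(sl₂)_e → T_e(x)`, `u ↦ ρ(x)(u)|_{ℂ^{X_e}}`. It is onto, and a
`T_e(x)`-module is a `U(sl₂)_e`-module by pulling back along it. -/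
noncomputable def toTe {D : ℕ} (x : X D) : Ue →ₐ[ℂ] Te x :=
  (rhoE x).codRestrict (Te x) (rhoE_mem x)

theorem toTe_surjective {D : ℕ} (x : X D) : Function.Surjective (toTe x) := by
  have hle : Te x ≤ (rhoE x).range := by
    refine Algebra.adjoin_le ?_
    rintro _ (rfl | rfl)
    · have hw : ∀ a b : Gen, Even (a.deg + b.deg) → gen a * gen b ∈ Ue := fun a b h =>
        (mem_Ue_iff _).2 (Submodule.subset_span
          ⟨[a, b], by simpa [wordDeg] using h, by simp [word]⟩)
      have hQ : (gen .E + gen .F) * (gen .E + gen .F) ∈ Ue := by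
        rw [mul_add, add_mul, add_mul]
        refine Ue.add_mem (Ue.add_mem ?_ ?_) (Ue.add_mem ?_ ?_) <;>
          exact hw _ _ (by simp [Gen.deg])
      refine ⟨⟨_, hQ⟩, ?_⟩
      change rhoE x ⟨_, hQ⟩ = adjSqE D
      ext1 v; apply Subtype.ext
      change rho x _ v = (adj D ^ 2) v
      rw [rho_EF]
    · have hH : gen .H ∈ Ue := (mem_Ue_iff _).2 (Submodule.subset_span
        ⟨[.H], by simp [wordDeg, Gen.deg], by simp [word]⟩)
      refine ⟨⟨gen .H, hH⟩, ?_⟩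
      change rhoE x ⟨gen .H, hH⟩ = dualAdjE x
      ext1 v; apply Subtype.ext
      change rho x (gen .H) v = dualAdj x v
      rw [rho_H]
  rintro ⟨t, ht⟩
  obtain ⟨u, hu⟩ := hle ht
  exact ⟨u, Subtype.ext hu⟩

/-- The `T_e(x)`-module structure on `W` induces the given `U(sl₂)_e`-module structure on `W` by
pulling back along `toTe x`. As `toTe x` is onto, there is at most one such structure. -/
def Induces {D : ℕ} (x : X D) (W : Type*) [AddCommGroup W] [Module Ue W] [Module (Te x) W] :
    Prop :=
  ∀ (u : Ue) (w : W), toTe x u • w = u • w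

/-! ### The index sets of the list of irreducible modules -/

/-- The indices `k`: even `k` with `0 ≤ k ≤ ⌊D/2⌋`. -/
abbrev EvenIdx (D : ℕ) : Type := {k : ℕ // Even k ∧ k ≤ D / 2}

/-- The indices `k`: odd `k` with `1 ≤ k ≤ ⌊(D-1)/2⌋`. -/
abbrev OddIdx (D : ℕ) : Type := {k : ℕ // Odd k ∧ k ≤ (D - 1) / 2}

end HalvedCube

open HalvedCube

/-!
The algebra `T_e(x)` is a quotient of `U(sl₂)_e`. So is the product of the endomorphism algebras of
the listed modules, and the two quotients have the same kernel; everything else is the structure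
theory of products of matrix algebras.

* The action of `U(sl₂)_e` on a single listed module is onto its linear endomorphisms
  (`exists_smul_eq_end`): interpolation polynomials in `H` project to the weight spaces, which are
  one-dimensional, and powers of `E²` and `F²` move any weight vector to any other one. The Casimir
  element acts on the listed modules by different scalars, so that the action on the product is onto
  as well (`irrRep_surjective`).

* An element acting as zero on `ℂ^{X_e}` acts as zero on every listed module
  (`irrRep_eq_zero_of_toTe`). For `k ≤ D/2` the sphere of radius `k` in the hypercube has more
  vertices than the one of radius `k - 1`, hence `E` kills a nonzero vector of weight `D - 2k`
  (`exists_primitive`). Such a vector generates a copy of `L_{D-2k}` in `ℂ^X`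
  (`exists_embedding_of_primitive`), and the listed submodule of `L_{D-2k}` is the part of this copy
  which lies in `ℂ^{X_e}`.

* An element acting as zero on every listed module acts as zero on `ℂ^{X_e}`
  (`toTe_eq_zero_of_irrRep`). The operators `E` and `F` are adjoint to each other for the Hermitian
  form with orthonormal basis `X`, hence `ℂ^X = ker E + im F` (`ker_E_sup_range_F`). As `F` is
  nilpotent, `ℂ^X` is spanned by the vectors `F^i p` with `p` a weight vector killed by `E`, and each
  of those lies in a copy of some `L_{D-2k}`. By parity of the weights, the vectors of this form in
  `ℂ^{X_e}` span `ℂ^{X_e}` and belong to copies of the listed modules.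

The dimension of `T_e(x)` is then a sum of squares over the even `k` plus one over the odd `k`, and
each of the two telescopes to a binomial coefficient (`sum_even_sq`, `sum_odd_sq`).
-/

namespace HalvedCube

/-! ### Primitive vectors in representations of `U(sl₂)` -/

/-- A linear map between representations of `U(sl₂)` which commutes with the generators commutes
with all of `U(sl₂)`. -/
theorem rep_ext_gen {V W : Type*} [AddCommGroup V] [Module ℂ V] [AddCommGroup W] [Module ℂ W]
    (R : U →ₐ[ℂ] Module.End ℂ V) (S : U →ₐ[ℂ] Module.End ℂ W) (φ : V →ₗ[ℂ] W)
    (h : ∀ g v, φ (R (gen g) v) = S (gen g) (φ v)) (u : U) (v : V) :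
    φ (R u v) = S u (φ v) := by
  obtain ⟨q, hq, hqs⟩ : ∃ q : FreeAlgebra ℂ Gen →ₐ[ℂ] U,
      (∀ g, q (FreeAlgebra.ι ℂ g) = gen g) ∧ Function.Surjective q :=
    ⟨RingQuot.mkAlgHom ℂ Rel, fun _ => rfl, RingQuot.mkAlgHom_surjective ℂ Rel⟩
  obtain ⟨a, rfl⟩ := hqs u
  induction a using FreeAlgebra.induction generalizing v with
  | grade0 r => simp
  | grade1 g => rw [hq]; exact h g v
  | mul a b ha hb => rw [map_mul, map_mul, map_mul, Module.End.mul_apply, ha, hb,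
      Module.End.mul_apply]
  | add a b ha hb => rw [map_add, map_add, map_add, LinearMap.add_apply, map_add, ha, hb,
      LinearMap.add_apply]

section Primitive

variable {V : Type*} [AddCommGroup V] [Module ℂ V] (R : U →ₐ[ℂ] Module.End ℂ V)

/-- The divided powers `F^i v / i!`. -/
noncomputable def divPow (v : V) (i : ℕ) : V := ((i.factorial : ℂ)⁻¹) • (R (gen .F) ^ i) v

theorem divPow_zero (v : V) : divPow R v 0 = v := by simp [divPow]

theorem F_divPow (v : V) (i : ℕ) :
    R (gen .F) (divPow R v i) = ((i : ℂ) + 1) • divPow R v (i + 1) := by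
  have h : (i : ℂ) + 1 ≠ 0 := by exact_mod_cast i.succ_ne_zero
  simp only [divPow, map_smul, smul_smul, pow_succ', Module.End.mul_apply, Nat.factorial_succ]
  congr 1
  push_cast
  field_simp

theorem F_pow_eq_divPow (v : V) (i : ℕ) :
    (R (gen .F) ^ i) v = (i.factorial : ℂ) • divPow R v i := by
  have h : (i.factorial : ℂ) ≠ 0 := by exact_mod_cast i.factorial_ne_zero
  rw [divPow, smul_smul, mul_inv_cancel₀ h, one_smul]

theorem rep_HF (w : V) : R (gen .H) (R (gen .F) w) =
    R (gen .F) (R (gen .H) w) - (2 : ℂ) • R (gen .F) w := by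
  have := congrArg (fun T => R T w) gen_HF
  simp only [map_sub, map_mul, map_smul, LinearMap.sub_apply, Module.End.mul_apply,
    LinearMap.smul_apply] at this
  rw [sub_eq_iff_eq_add.1 this]; module

theorem rep_HE (w : V) : R (gen .H) (R (gen .E) w) =
    R (gen .E) (R (gen .H) w) + (2 : ℂ) • R (gen .E) w := by
  have := congrArg (fun T => R T w) gen_HE
  simp only [map_sub, map_mul, map_smul, LinearMap.sub_apply, Module.End.mul_apply,
    LinearMap.smul_apply] at this
  rw [sub_eq_iff_eq_add.1 this]; module

theorem rep_EF (w : V) : R (gen .E) (R (gen .F) w) =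
    R (gen .F) (R (gen .E) w) + R (gen .H) w := by
  have := congrArg (fun T => R T w) gen_EF
  simp only [map_sub, map_mul, LinearMap.sub_apply, Module.End.mul_apply] at this
  rw [sub_eq_iff_eq_add.1 this]; module

variable {R} {v : V} {μ : ℂ}

theorem H_divPow (hH : R (gen .H) v = μ • v) (i : ℕ) :
    R (gen .H) (divPow R v i) = (μ - 2 * i) • divPow R v i := by
  induction i with
  | zero => simp [divPow_zero, hH]
  | succ i ih =>
    have h : (i : ℂ) + 1 ≠ 0 := by exact_mod_cast i.succ_ne_zero
    refine smul_right_injective V h ?_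
    simp only
    rw [← map_smul, ← F_divPow, rep_HF, ih, map_smul, F_divPow, smul_comm, ← F_divPow]
    rw [F_divPow]
    push_cast
    module

theorem E_divPow (hE : R (gen .E) v = 0) (hH : R (gen .H) v = μ • v) (i : ℕ) :
    R (gen .E) (divPow R v (i + 1)) = (μ - i) • divPow R v i := by
  induction i with
  | zero =>
    have := F_divPow R v 0
    simp only [Nat.cast_zero, zero_add, one_smul] at this
    rw [zero_add, ← this, rep_EF, divPow_zero, hE, hH]
    simp
  | succ i ih =>
    have h : ((i + 1 : ℕ) : ℂ) + 1 ≠ 0 := by exact_mod_cast (i + 1).succ_ne_zero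
    refine smul_right_injective V h ?_
    simp only
    rw [← map_smul, ← F_divPow, rep_EF, ih, H_divPow hH, map_smul, F_divPow]
    push_cast
    module

theorem divPow_linearIndependent (hH : R (gen .H) v = μ • v) {s : Set ℕ}
    (hs : ∀ i ∈ s, divPow R v i ≠ 0) : LinearIndependent ℂ fun i : s => divPow R v i := by
  refine Module.End.eigenvectors_linearIndependent' (R (gen .H)) (fun i : s => μ - 2 * (i : ℕ))
    (fun i j hij => ?_) _ fun i => ⟨?_, hs i i.2⟩
  · simpa [Subtype.ext_iff] using hij
  · rw [Module.End.mem_eigenspace_iff]; exact H_divPow hH i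

/-- A nonzero vector of weight `μ` killed by `E` in a finite-dimensional representation has
`μ = n` for a natural number `n`, and is the image of `v_0` under an embedding of `L_n`. -/
theorem exists_embedding_of_primitive [FiniteDimensional ℂ V] (hv : v ≠ 0)
    (hE : R (gen .E) v = 0) (hH : R (gen .H) v = μ • v) :
    ∃ n : ℕ, μ = n ∧ ∃ φ : L n →ₗ[ℂ] V, Function.Injective φ ∧
      (∀ i, φ (L.v n i) = divPow R v i) ∧ ∀ u y, φ (L.rep n u y) = R u (φ y) := by
  classical
  -- the `F^i v / i!` have different weights, so only finitely many of them are nonzero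
  have hex : ∃ i, divPow R v i = 0 := by
    by_contra! h
    have := (divPow_linearIndependent (s := Set.univ) hH fun i _ => h i).finite
    exact Set.infinite_univ (Set.toFinite (Set.univ : Set ℕ))
  obtain ⟨n, hn⟩ : ∃ n, Nat.find hex = n + 1 := by
    refine Nat.exists_eq_succ_of_ne_zero fun h0 => ?_
    have := Nat.find_spec hex
    rw [h0, divPow_zero] at this
    exact hv this
  have hz : divPow R v (n + 1) = 0 := hn ▸ Nat.find_spec hex
  have hnz : ∀ i ≤ n, divPow R v i ≠ 0 := fun i hi => Nat.find_min hex (by omega)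
  have hμ : μ = n := by
    have := E_divPow hE hH n
    rw [hz, map_zero, eq_comm, smul_eq_zero, or_iff_left (hnz n le_rfl), sub_eq_zero] at this
    exact this
  have hz' : ∀ i, n < i → divPow R v i = 0 := by
    intro i hi
    induction i, hi using Nat.le_induction with
    | base => exact hz
    | succ i _ ih =>
      have h : (i : ℂ) + 1 ≠ 0 := by exact_mod_cast i.succ_ne_zero
      have := F_divPow R v i
      rw [ih, map_zero, eq_comm, smul_eq_zero, or_iff_right h] at this
      exact this
  let φ : L n →ₗ[ℂ] V := (L.basis n).constr ℂ fun i : Fin (n + 1) => divPow R v i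
  have hφ : ∀ i, φ (L.v n i) = divPow R v i := by
    intro i
    by_cases hi : i < n + 1
    · simp only [L.v, dif_pos hi, φ, Module.Basis.constr_basis]
    · rw [L.v_of_gt (by omega), map_zero, hz' i (by omega)]
  refine ⟨n, hμ, φ, ?_, hφ, rep_ext_gen _ _ φ fun g y => ?_⟩
  · rw [injective_iff_map_eq_zero]
    intro y hy
    have li : LinearIndependent ℂ fun i : Fin (n + 1) => divPow R v i := by
      have := divPow_linearIndependent (R := R) (s := Set.Iio (n + 1)) hH
        fun i hi => hnz i (Nat.lt_succ_iff.1 hi)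
      exact this.comp (fun i : Fin (n + 1) => (⟨i, i.2⟩ : Set.Iio (n + 1)))
        fun i j h => Fin.ext (congrArg Subtype.val h)
    rw [Module.Basis.constr_apply_fintype] at hy
    have := Fintype.linearIndependent_iff.1 li _ hy
    exact (L.basis n).equivFun.map_eq_zero_iff.1 (funext this)
  · suffices h : φ ∘ₗ L.rep n (gen g) = R (gen g) ∘ₗ φ from LinearMap.congr_fun h y
    refine (L.basis n).ext fun i => ?_
    have hi : L.basis n i = L.v n i := by rw [L.v, dif_pos i.2]
    rw [hi]
    change φ (L.rep n (gen g) (L.v n i)) = R (gen g) (φ (L.v n i))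
    rw [show L.rep n (gen g) = L.act n g from U.lift_gen _ _ _ _ g, hφ]
    generalize (i : ℕ) = i
    cases g with
    | E =>
      cases i with
      | zero => rw [L.E_zero, divPow_zero, hE, map_zero]
      | succ i => rw [L.E_succ, E_divPow hE hH, map_smul, hφ, hμ]
    | F => rw [L.F_v, F_divPow, map_smul, hφ]
    | H => rw [L.H_v, H_divPow hH, map_smul, hφ, hμ]

end Primitive

/-! ### Words of even degree acting on `L_n` -/

namespace L

theorem gen_smul (n : ℕ) (g : Gen) (w : L n) : gen g • w = L.act n g w := by
  rw [L.smul_def, show L.rep n (gen g) = L.act n g from U.lift_gen _ _ _ _ g]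

theorem basis_eq_v (n : ℕ) (i : Fin (n + 1)) : L.basis n i = L.v n i := by
  rw [L.v, dif_pos i.2]

theorem F_pow_v (n m i : ℕ) :
    ∃ c : ℂ, c ≠ 0 ∧ gen .F ^ m • L.v n i = c • L.v n (i + m) := by
  induction m with
  | zero => exact ⟨1, one_ne_zero, by simp⟩
  | succ m ih =>
    obtain ⟨c, hc, h⟩ := ih
    have h1 : ((i + m : ℕ) : ℂ) + 1 ≠ 0 := by exact_mod_cast (i + m).succ_ne_zero
    refine ⟨c * (((i + m : ℕ) : ℂ) + 1), mul_ne_zero hc h1, ?_⟩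
    rw [pow_succ', mul_smul, h, smul_comm, gen_smul, L.F_v, smul_smul, add_assoc]

theorem E_pow_v (n m i : ℕ) (h : i + m ≤ n) :
    ∃ c : ℂ, c ≠ 0 ∧ gen .E ^ m • L.v n (i + m) = c • L.v n i := by
  induction m with
  | zero => exact ⟨1, one_ne_zero, by simp⟩
  | succ m ih =>
    obtain ⟨c, hc, hm⟩ := ih (by omega)
    have h1 : (n : ℂ) - (i + m : ℕ) ≠ 0 := by
      rw [sub_ne_zero]; norm_cast; omega
    refine ⟨((n : ℂ) - (i + m : ℕ)) * c, mul_ne_zero h1 hc, ?_⟩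
    rw [pow_succ, mul_smul, ← add_assoc, gen_smul, L.E_succ, smul_comm, hm, smul_smul]

end L

theorem word_mem_Ue (l : List Gen) (h : Even (wordDeg l)) : word l ∈ Ue :=
  (mem_Ue_iff _).2 (Submodule.subset_span ⟨l, h, rfl⟩)

theorem gen_pow_mem_Ue (g : Gen) (m : ℕ) (h : Even m) : gen g ^ m ∈ Ue := by
  have := word_mem_Ue (List.replicate m g) (by
    simp only [wordDeg, List.map_replicate, List.sum_replicate, nsmul_eq_mul]
    exact (Int.even_coe_nat m).2 h |>.mul_right _)
  simpa [word] using this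

/-- `H` as an element of the even subalgebra. -/
noncomputable def evenH : Ue :=
  ⟨gen .H, by simpa [word] using word_mem_Ue [.H] (by simp [wordDeg, Gen.deg])⟩

/-- The Casimir element `4FE + H² + 2H`, which acts on `L_n` as the scalar `n² + 2n`. -/
noncomputable def casimir : Ue :=
  (4 : ℂ) • ⟨gen .F * gen .E,
    by simpa [word] using word_mem_Ue [.F, .E] (by simp [wordDeg, Gen.deg])⟩ +
    evenH * evenH + (2 : ℂ) • evenH

theorem evenH_v (n i : ℕ) : evenH • L.v n i = ((n : ℂ) - 2 * i) • L.v n i := by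
  rw [← L.H_v, ← L.gen_smul]; rfl

theorem casimir_smul (n : ℕ) (w : L n) : casimir • w = ((n : ℂ) ^ 2 + 2 * n) • w := by
  have key : ∀ i, casimir • L.v n i = ((n : ℂ) ^ 2 + 2 * n) • L.v n i := by
    intro i
    have hFE : (⟨gen .F * gen .E,
        by simpa [word] using word_mem_Ue [.F, .E] (by simp [wordDeg, Gen.deg])⟩ : Ue) • L.v n i =
        L.act n .F (L.act n .E (L.v n i)) := by
      rw [← L.gen_smul, ← L.gen_smul, ← mul_smul]; rfl
    rw [casimir, add_smul, add_smul, mul_smul, smul_assoc, smul_assoc, hFE, evenH_v,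
      smul_comm evenH, evenH_v]
    cases i with
    | zero => rw [L.E_zero, map_zero]; push_cast; module
    | succ i => rw [L.E_succ, map_smul, L.F_v]; push_cast; module
  rw [← (L.basis n).sum_repr w, Finset.smul_sum, Finset.smul_sum]
  refine Finset.sum_congr rfl fun i _ => ?_
  rw [L.basis_eq_v, smul_comm, key, smul_comm]

/-- Polynomials in an element act on its eigenvectors through the eigenvalue. -/
theorem aeval_smul_of_smul_eq {A M : Type*} [Ring A] [Algebra ℂ A] [AddCommGroup M] [Module ℂ M]
    [Module A M] [IsScalarTower ℂ A M] {a : A} {μ : ℂ} {m : M} (h : a • m = μ • m)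
    (p : Polynomial ℂ) : Polynomial.aeval a p • m = p.eval μ • m := by
  have hcomm : ∀ (c : ℂ) (b : A), b • c • m = c • b • m := fun c b => by
    rw [← algebraMap_smul A c m, ← algebraMap_smul A c (b • m), smul_smul, smul_smul,
      Algebra.commutes]
  induction p using Polynomial.induction_on' with
  | add p q hp hq => rw [map_add, add_smul, hp, hq, Polynomial.eval_add, add_smul]
  | monomial k c =>
    have hk : a ^ k • m = μ ^ k • m := by
      induction k with
      | zero => simp
      | succ k ih => rw [pow_succ', mul_smul, ih, hcomm, h, smul_smul, pow_succ]
    rw [Polynomial.aeval_monomial, Polynomial.eval_monomial, mul_smul, hk, algebraMap_smul,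
      smul_smul]

/-! ### The submodules `L_n⁽⁰⁾` and `L_n⁽¹⁾` -/

section wtSumL

theorem L.repr_H (n : ℕ) (w : L n) (i : Fin (n + 1)) :
    (L.basis n).repr (gen .H • w) i = ((n : ℂ) - 2 * (i : ℕ)) * (L.basis n).repr w i := by
  rw [L.gen_smul]
  suffices h : (L.basis n).coord i ∘ₗ L.act n .H =
      ((n : ℂ) - 2 * (i : ℕ)) • (L.basis n).coord i from LinearMap.congr_fun h w
  refine (L.basis n).ext fun j => ?_
  rw [LinearMap.comp_apply, L.basis_eq_v, L.H_v, ← L.basis_eq_v]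
  by_cases hij : j = i
  · subst hij; simp
  · simp [Finsupp.single_eq_of_ne' hij]

variable {n : ℕ} {θ : ℂ} {ε : ℕ}

theorem v_mem_wtSum (hθ : θ = n - 2 * ε) (i : ℕ) :
    L.v n (2 * i + ε) ∈ wtSum (L n) θ := by
  change L.v n (2 * i + ε) ∈ (⨆ i : ℤ, wt (L n) (θ - 4 * i) : Submodule ℂ (L n))
  refine Submodule.mem_iSup_of_mem (i : ℤ) ?_
  change gen .H • L.v n (2 * i + ε) = _
  rw [L.gen_smul, L.H_v, hθ]
  congr 1; push_cast; ring

theorem repr_eq_zero_of_mem_wtSum (hθ : θ = n - 2 * ε) {w : L n} (hw : w ∈ wtSum (L n) θ)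
    (j : Fin (n + 1)) (hj : (j : ℕ) % 2 ≠ ε % 2) : (L.basis n).repr w j = 0 := by
  have hle : (⨆ i : ℤ, wt (L n) (θ - 4 * i) : Submodule ℂ (L n)) ≤
      LinearMap.ker ((L.basis n).coord j) := by
    refine iSup_le fun i u hu => ?_
    have h1 : gen .H • u = (θ - 4 * i) • u := hu
    have h2 := L.repr_H n u j
    rw [h1, map_smul, Finsupp.smul_apply, smul_eq_mul] at h2
    rw [LinearMap.mem_ker, Module.Basis.coord_apply]
    by_contra h0
    have h3 := mul_right_cancel₀ h0 h2
    rw [hθ] at h3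
    have h4 : ((j : ℕ) : ℤ) = ε + 2 * i := by
      have : (((j : ℕ) : ℤ) : ℂ) = ((ε + 2 * i : ℤ) : ℂ) := by
        push_cast; linear_combination h3 / 2
      exact_mod_cast this
    omega
  exact hle hw

/-- The vectors `v_ε, v_{ε+2}, …` form a basis of `⨁_{i ∈ ℤ} L_n(n - 2ε - 4i)`, for
`ε ∈ {0, 1}`. -/
noncomputable def wtSumEquiv (hθ : θ = n - 2 * ε) (hε : ε < 2) :
    wtSum (L n) θ ≃ₗ[ℂ] (Fin ((n + 2 - ε) / 2) → ℂ) where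
  toFun w t := (L.basis n).repr (w : L n) ⟨2 * t + ε, by have := t.2; omega⟩
  map_add' a b := by ext t; simp
  map_smul' c a := by ext t; simp
  invFun f := ⟨∑ t, f t • L.v n (2 * t + ε), by
    refine Submodule.sum_mem _ fun t _ => ?_
    exact Submodule.smul_of_tower_mem _ _ (v_mem_wtSum hθ t)⟩
  left_inv w := by
    apply Subtype.ext
    apply (L.basis n).repr.injective
    ext j
    by_cases hj : (j : ℕ) % 2 = ε
    · have hjn := j.2
      simp only [map_sum, map_smul, Finsupp.finsetSum_apply, Finsupp.smul_apply, smul_eq_mul]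
      rw [Finset.sum_eq_single ⟨(j : ℕ) / 2, by omega⟩]
      · have : (⟨2 * ((j : ℕ) / 2) + ε, by omega⟩ : Fin (n + 1)) = j := Fin.ext (by simp; omega)
        simp only [this]
        rw [show 2 * ((j : ℕ) / 2) + ε = j by omega, ← L.basis_eq_v]; simp
      · intro t _ ht
        have ht2 := t.2
        have hne : (⟨2 * t + ε, by omega⟩ : Fin (n + 1)) ≠ j := fun h => ht (Fin.ext (by
          have := congrArg Fin.val h; simp at this ⊢; omega))
        rw [L.v, dif_pos (by omega)]
        simp [Finsupp.single_eq_of_ne' hne]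
      · simp
    · rw [repr_eq_zero_of_mem_wtSum hθ w.2 j (by omega)]
      exact repr_eq_zero_of_mem_wtSum hθ (Subtype.property _) j (by omega)
  right_inv f := by
    ext s
    simp only [map_sum, map_smul, Finsupp.finsetSum_apply, Finsupp.smul_apply, smul_eq_mul]
    rw [Finset.sum_eq_single s]
    · have := s.2
      rw [L.v, dif_pos (by omega)]; simp
    · intro t _ ht
      have ht2 := t.2
      rw [L.v, dif_pos (by omega)]
      have hne : (⟨2 * t + ε, by omega⟩ : Fin (n + 1)) ≠ ⟨2 * s + ε, by omega⟩ := fun h =>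
        ht (Fin.ext (by simpa using h))
      simp [Finsupp.single_eq_of_ne' hne]
    · simp

/-- Each of the weight vectors spanning `⨁_{i ∈ ℤ} L_n(n - 2ε - 4i)` generates it over the even
subalgebra: a power of `E²` or of `F²` moves it to a multiple of any other one. -/
theorem exists_smul_v_eq (hθ : θ = n - 2 * ε) (hε : ε < 2) {i : ℕ} (hi : 2 * i + ε ≤ n)
    {w : L n} (hw : w ∈ wtSum (L n) θ) : ∃ u : Ue, u • L.v n (2 * i + ε) = w := by
  have key : ∀ j, 2 * j + ε ≤ n → ∃ u : Ue, u • L.v n (2 * i + ε) = L.v n (2 * j + ε) := by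
    intro j hj
    rcases le_total i j with h | h
    · obtain ⟨c, hc, hv⟩ := L.F_pow_v n (2 * (j - i)) (2 * i + ε)
      refine ⟨c⁻¹ • ⟨_, gen_pow_mem_Ue .F (2 * (j - i)) (even_two_mul _)⟩, ?_⟩
      rw [smul_assoc]
      change c⁻¹ • gen .F ^ (2 * (j - i)) • L.v n (2 * i + ε) = _
      rw [hv, smul_smul, inv_mul_cancel₀ hc, one_smul]
      congr 1; omega
    · obtain ⟨c, hc, hv⟩ := L.E_pow_v n (2 * (i - j)) (2 * j + ε) (by omega)
      refine ⟨c⁻¹ • ⟨_, gen_pow_mem_Ue .E (2 * (i - j)) (even_two_mul _)⟩, ?_⟩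
      rw [smul_assoc]
      change c⁻¹ • gen .E ^ (2 * (i - j)) • L.v n (2 * i + ε) = _
      rw [show 2 * j + ε + 2 * (i - j) = 2 * i + ε by omega] at hv
      rw [hv, smul_smul, inv_mul_cancel₀ hc, one_smul]
  have hsum : w = ∑ t, wtSumEquiv hθ hε ⟨w, hw⟩ t • L.v n (2 * t + ε) :=
    congrArg Subtype.val ((wtSumEquiv hθ hε).symm_apply_apply ⟨w, hw⟩).symm
  choose! a ha using key
  refine ⟨∑ t : Fin ((n + 2 - ε) / 2), wtSumEquiv hθ hε ⟨w, hw⟩ t • a t, ?_⟩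
  rw [Finset.sum_smul]
  refine (Finset.sum_congr rfl fun t _ => ?_).trans hsum.symm
  have := t.2
  rw [smul_assoc, ha t (by omega)]

/-- Every linear endomorphism of `⨁_{i ∈ ℤ} L_n(n - 2ε - 4i)` is the action of an element of the
even subalgebra. -/
theorem exists_smul_eq_end (hθ : θ = n - 2 * ε) (hε : ε < 2)
    (T : Module.End ℂ (wtSum (L n) θ)) : ∃ u : Ue, ∀ w, u • w = T w := by
  classical
  let b : Fin ((n + 2 - ε) / 2) → wtSum (L n) θ := fun t => ⟨_, v_mem_wtSum hθ t⟩
  have ha : ∀ t, ∃ u : Ue, u • b t = T (b t) := by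
    intro t
    have := t.2
    obtain ⟨u, hu⟩ := exists_smul_v_eq hθ hε (i := t) (by omega) (T (b t)).2
    exact ⟨u, Subtype.ext hu⟩
  choose a ha using ha
  -- interpolation in the eigenvalues of `H` gives the projections to the weight spaces
  have hp : ∀ t : Fin ((n + 2 - ε) / 2), ∃ p : Polynomial ℂ, ∀ s : Fin ((n + 2 - ε) / 2),
      p.eval ((n : ℂ) - 2 * (2 * s + ε : ℕ)) = if s = t then 1 else 0 := by
    intro t
    refine (Polynomial.exists_eval_eq_iff _ _).2 fun i j hij => ?_
    have : i = j := by
      rw [sub_right_inj, mul_right_inj' two_ne_zero, Nat.cast_inj] at hij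
      exact Fin.ext (by omega)
    rw [this]
  choose p hp using hp
  refine ⟨∑ t, a t * Polynomial.aeval evenH (p t), fun w => ?_⟩
  have hb : ∀ s, (∑ t, a t * Polynomial.aeval evenH (p t)) • b s = T (b s) := by
    intro s
    have hH : evenH • b s = ((n : ℂ) - 2 * (2 * s + ε : ℕ)) • b s :=
      Subtype.ext (evenH_v n _)
    rw [Finset.sum_smul, Finset.sum_eq_single s]
    · rw [mul_smul, aeval_smul_of_smul_eq hH, hp, if_pos rfl, one_smul, ha]
    · intro t _ hts
      rw [mul_smul, aeval_smul_of_smul_eq hH, hp, if_neg hts.symm, zero_smul, smul_zero]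
    · simp
  have hw : w = ∑ t, wtSumEquiv hθ hε w t • b t := by
    conv_lhs => rw [← (wtSumEquiv hθ hε).symm_apply_apply w]
    apply Subtype.ext
    rw [AddSubmonoidClass.coe_finsetSum]; rfl
  rw [hw, Finset.smul_sum, map_sum]
  refine Finset.sum_congr rfl fun t _ => ?_
  rw [smul_comm, hb, map_smul]

end wtSumL

/-! ### Weight vectors of `ℂ^X` -/

section Cube

variable {D : ℕ}

theorem mem_supp_iff {s : Set (X D)} {v : CX D} :
    v ∈ supp s ↔ ∀ y ∉ s, (vert D).repr v y = 0 := by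
  rw [supp, Module.Basis.mem_span_image]
  constructor
  · intro h y hy
    by_contra h0
    exact hy (h (Finsupp.mem_support_iff.2 h0))
  · intro h y hy
    by_contra h0
    exact Finsupp.mem_support_iff.1 hy (h y h0)

theorem dualAdj_repr (x : X D) (v : CX D) (y : X D) :
    (vert D).repr (dualAdj x v) y = ((D : ℂ) - 2 * hammingDist x y) * (vert D).repr v y := by
  suffices h : (vert D).coord y ∘ₗ dualAdj x =
      ((D : ℂ) - 2 * hammingDist x y) • (vert D).coord y from LinearMap.congr_fun h v
  refine (vert D).ext fun z => ?_
  rw [LinearMap.comp_apply, dualAdj, Module.Basis.constr_basis]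
  by_cases h : z = y
  · subst h; simp
  · simp [Finsupp.single_eq_of_ne' h]

theorem sig_repr (i : Fin D) (v : CX D) (y : X D) :
    (vert D).repr (sig i v) y = (vert D).repr v (flip i y) := by
  suffices h : (vert D).coord y ∘ₗ sig i = (vert D).coord (flip i y) from
    LinearMap.congr_fun h v
  refine (vert D).ext fun z => ?_
  rw [LinearMap.comp_apply, sig_single, Module.Basis.coord_apply, Module.Basis.coord_apply,
    Module.Basis.repr_self, Module.Basis.repr_self]
  by_cases h : z = flip i y
  · rw [h, flip_flip]; simp
  · have h' : flip i z ≠ y := fun e => h (by rw [← e, flip_flip])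
    rw [Finsupp.single_eq_of_ne' h, Finsupp.single_eq_of_ne' h']

theorem weight_repr {x : X D} {μ : ℂ} {v : CX D} (hv : dualAdj x v = μ • v) {y : X D}
    (hy : (vert D).repr v y ≠ 0) : μ = D - 2 * hammingDist x y := by
  have h := dualAdj_repr x v y
  rw [hv, map_smul, Finsupp.smul_apply, smul_eq_mul] at h
  exact mul_right_cancel₀ hy h

theorem exists_weight_eq {x : X D} {μ : ℂ} {v : CX D} (hv : dualAdj x v = μ • v) (h0 : v ≠ 0) :
    ∃ j : ℕ, j ≤ D ∧ μ = D - 2 * j := by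
  obtain ⟨y, hy⟩ : ∃ y, (vert D).repr v y ≠ 0 := by
    by_contra! h
    exact h0 ((vert D).repr.map_eq_zero_iff.1 (Finsupp.ext h))
  refine ⟨hammingDist x y, ?_, weight_repr hv hy⟩
  simpa using hammingDist_le_card_fintype (x := x) (y := y)

theorem weight_mem_supp {x : X D} {j : ℕ} {v : CX D}
    (hv : dualAdj x v = ((D : ℂ) - 2 * j) • v) : v ∈ supp {y | hammingDist x y = j} := by
  refine mem_supp_iff.2 fun y hy => ?_
  by_contra h
  have := weight_repr hv h
  rw [sub_right_inj, mul_right_inj' two_ne_zero, Nat.cast_inj] at this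
  exact hy this.symm

theorem supp_weight {x : X D} {j : ℕ} {v : CX D} (hv : v ∈ supp {y | hammingDist x y = j}) :
    dualAdj x v = ((D : ℂ) - 2 * j) • v := by
  apply (vert D).repr.injective
  ext y
  rw [dualAdj_repr, map_smul, Finsupp.smul_apply, smul_eq_mul]
  by_cases h : hammingDist x y = j
  · rw [h]
  · rw [mem_supp_iff.1 hv y h, mul_zero, mul_zero]

theorem mem_Xe_iff_even_dist {x : X D} (hx : x ∈ Xe D) (y : X D) :
    y ∈ Xe D ↔ Even (hammingDist x y) := by
  have hx' : Even (∑ i, (x i : ℕ)) := hx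
  have h : ((∑ i, (x i : ℕ) : ℕ) : ZMod 2) + ((∑ i, (y i : ℕ) : ℕ) : ZMod 2) =
      (hammingDist x y : ZMod 2) := by
    rw [hammingDist, Finset.card_filter, Nat.cast_sum, Nat.cast_sum, Nat.cast_sum,
      ← Finset.sum_add_distrib]
    refine Finset.sum_congr rfl fun i _ => ?_
    generalize x i = a
    generalize y i = b
    revert a b
    decide
  rw [(ZMod.natCast_eq_zero_iff_even).2 hx', zero_add] at h
  change Even (∑ i, (y i : ℕ)) ↔ _
  rw [← ZMod.natCast_eq_zero_iff_even, h, ZMod.natCast_eq_zero_iff_even]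

theorem supp_mono {s t : Set (X D)} (h : s ⊆ t) : supp s ≤ supp t :=
  Submodule.span_mono (Set.image_mono h)

theorem weight_mem_CXe {x : X D} (hx : x ∈ Xe D) {j : ℕ} {v : CX D}
    (hv : dualAdj x v = ((D : ℂ) - 2 * j) • v) (hj : Even j) : v ∈ CXe D :=
  supp_mono (fun y (hy : hammingDist x y = j) =>
    (mem_Xe_iff_even_dist hx y).2 (hy ▸ hj)) (weight_mem_supp hv)

theorem weight_mem_CXo {x : X D} (hx : x ∈ Xe D) {j : ℕ} {v : CX D}
    (hv : dualAdj x v = ((D : ℂ) - 2 * j) • v) (hj : ¬ Even j) : v ∈ CXo D :=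
  supp_mono (fun y (hy : hammingDist x y = j) h =>
    hj (hy ▸ (mem_Xe_iff_even_dist hx y).1 h)) (weight_mem_supp hv)

theorem eq_zero_of_mem_CXe_of_mem_CXo {v : CX D} (he : v ∈ CXe D) (ho : v ∈ CXo D) : v = 0 := by
  refine (vert D).repr.map_eq_zero_iff.1 (Finsupp.ext fun y => ?_)
  by_cases hy : y ∈ Xe D
  · exact mem_supp_iff.1 ho y fun h => h hy
  · exact mem_supp_iff.1 he y hy

/-! ### Complete reducibility of `ℂ^X` -/

/-- The Hermitian form on `ℂ^X` for which the vertices are orthonormal. -/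
noncomputable def herm (p q : CX D) : ℂ :=
  ∑ y, (starRingEnd ℂ) ((vert D).repr p y) * (vert D).repr q y

theorem herm_self_eq_zero {p : CX D} (h : herm p p = 0) : p = 0 := by
  have h1 : ∀ y, (starRingEnd ℂ) ((vert D).repr p y) * (vert D).repr p y =
      ((Complex.normSq ((vert D).repr p y) : ℝ) : ℂ) := fun y => by
    rw [mul_comm, Complex.mul_conj]
  rw [herm, Finset.sum_congr rfl fun y _ => h1 y, ← Complex.ofReal_sum, Complex.ofReal_eq_zero,
    Finset.sum_eq_zero_iff_of_nonneg fun y _ => Complex.normSq_nonneg _] at h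
  refine (vert D).repr.map_eq_zero_iff.1 (Finsupp.ext fun y => ?_)
  exact Complex.normSq_eq_zero.1 (h y (Finset.mem_univ y))

theorem herm_add_right (p q q' : CX D) : herm p (q + q') = herm p q + herm p q' := by
  simp [herm, mul_add, Finset.sum_add_distrib]

theorem herm_smul_left (c : ℂ) (p q : CX D) :
    herm (c • p) q = (starRingEnd ℂ) c * herm p q := by
  simp [herm, Finset.mul_sum, mul_assoc]

theorem herm_smul_right (c : ℂ) (p q : CX D) : herm p (c • q) = c * herm p q := by
  simp [herm, Finset.mul_sum, mul_left_comm]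

theorem herm_sub_left (p p' q : CX D) : herm (p - p') q = herm p q - herm p' q := by
  simp [herm, sub_mul, Finset.sum_sub_distrib]

theorem herm_sub_right (p q q' : CX D) : herm p (q - q') = herm p q - herm p q' := by
  simp [herm, mul_sub, Finset.sum_sub_distrib]

theorem herm_zero_right (p : CX D) : herm p 0 = 0 := by simp [herm]

theorem herm_zero_left (p : CX D) : herm 0 p = 0 := by simp [herm]

theorem herm_dualAdj (x : X D) (p q : CX D) : herm (dualAdj x p) q = herm p (dualAdj x q) := by
  refine Finset.sum_congr rfl fun y _ => ?_
  rw [dualAdj_repr, dualAdj_repr, map_mul]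
  simp only [map_sub, map_mul, map_natCast, Complex.conj_ofNat]
  ring

theorem herm_adj (p q : CX D) : herm (adj D p) q = herm p (adj D q) := by
  simp only [adj_eq, LinearMap.sum_apply, herm, map_sum, Finsupp.finsetSum_apply, Finset.sum_mul,
    Finset.mul_sum, sig_repr]
  rw [Finset.sum_comm, Finset.sum_comm (s := Finset.univ (α := X D))]
  refine Finset.sum_congr rfl fun i _ => ?_
  let e : Equiv.Perm (X D) := ⟨flip i, flip i, flip_flip i, flip_flip i⟩
  refine Fintype.sum_equiv e _ _ fun y => ?_
  change _ = (starRingEnd ℂ) ((vert D).repr p (flip i y)) * (vert D).repr q (flip i (flip i y))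
  rw [flip_flip]

/-- With respect to the Hermitian form, `E` and `F` are adjoint to each other. -/
theorem herm_E (x : X D) (p q : CX D) :
    herm (rho x (gen .E) p) q = herm p (rho x (gen .F) q) := by
  simp only [rho_gen, rhoGen, LinearMap.sub_apply, LinearMap.add_apply, LinearMap.smul_apply,
    Module.End.mul_apply, herm_sub_left, herm_add_right, herm_sub_right, herm_smul_left,
    herm_smul_right, herm_adj, herm_dualAdj, map_inv₀, Complex.conj_ofNat]
  ring

instance : FiniteDimensional ℂ (CX D) := Module.Finite.of_basis (vert D)

/-- As `F` is the adjoint of `E`, the kernel of `E` and the image of `F` span `ℂ^X`. -/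
theorem ker_E_sup_range_F (x : X D) :
    LinearMap.ker (rho x (gen .E)) ⊔ LinearMap.range (rho x (gen .F)) = ⊤ := by
  set e := rho x (gen .E)
  set f := rho x (gen .F)
  have hker : ∀ p, f (e p) = 0 → e p = 0 := fun p hp => by
    apply herm_self_eq_zero
    rw [herm_E, hp, herm_zero_right]
  -- `F E` is self-adjoint, so its kernel and image are complementary
  have hdis : Disjoint (LinearMap.ker (f * e)) (LinearMap.range (f * e)) := by
    rw [Submodule.disjoint_def]
    rintro _ hp ⟨q, rfl⟩
    have h1 : e (f (e q)) = 0 := hker _ hp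
    have h2 : f (e q) = 0 := by
      apply herm_self_eq_zero
      rw [← herm_E]
      change herm (e (f (e q))) _ = 0
      rw [h1, herm_zero_left]
    exact h2
  have htop : LinearMap.ker (f * e) ⊔ LinearMap.range (f * e) = ⊤ := by
    have := (Submodule.isCompl_iff_disjoint _ _ (by
      rw [← (f * e).finrank_range_add_finrank_ker, add_comm])).2 hdis
    exact this.sup_eq_top
  rw [eq_top_iff, ← htop]
  refine sup_le_sup (fun p hp => hker p hp) ?_
  rintro _ ⟨q, rfl⟩
  exact ⟨e q, rfl⟩

theorem iSup_eigenspace_dualAdj (x : X D) :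
    ⨆ μ, (dualAdj x).genEigenspace μ 1 = ⊤ := by
  rw [eq_top_iff, ← (vert D).span_eq, Submodule.span_le]
  rintro _ ⟨y, rfl⟩
  refine Submodule.mem_iSup_of_mem ((D : ℂ) - 2 * hammingDist x y) ?_
  change _ ∈ (dualAdj x).eigenspace _
  rw [Module.End.mem_eigenspace_iff, dualAdj, Module.Basis.constr_basis]

/-- The vectors of the form `F^i p` with `p` a weight vector killed by `E`. -/
def lowered (x : X D) : Set (CX D) :=
  {w | ∃ (p : CX D) (μ : ℂ) (i : ℕ), rho x (gen .E) p = 0 ∧ dualAdj x p = μ • p ∧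
    w = (rho x (gen .F) ^ i) p}

theorem ker_E_le_span_lowered (x : X D) :
    LinearMap.ker (rho x (gen .E)) ≤ Submodule.span ℂ (lowered x) := by
  have hinv : ∀ p ∈ LinearMap.ker (rho x (gen .E)),
      dualAdj x p ∈ LinearMap.ker (rho x (gen .E)) := by
    intro p hp
    rw [LinearMap.mem_ker] at hp ⊢
    have := rep_HE (rho x) p
    rwa [hp, map_zero, smul_zero, add_zero, rho_H, eq_comm] at this
  rw [Submodule.eq_iSup_inf_genEigenspace 1 hinv (iSup_eigenspace_dualAdj x)]
  refine iSup_le fun μ p hp => Submodule.subset_span ⟨p, μ, 0, hp.1, ?_, by simp⟩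
  exact Module.End.mem_eigenspace_iff.1 hp.2

theorem F_pow_span_lowered (x : X D) (m : ℕ) {w : CX D}
    (hw : w ∈ Submodule.span ℂ (lowered x)) :
    (rho x (gen .F) ^ m) w ∈ Submodule.span ℂ (lowered x) := by
  induction hw using Submodule.span_induction with
  | zero => rw [map_zero]; exact Submodule.zero_mem _
  | add a b _ _ ha hb => rw [map_add]; exact Submodule.add_mem _ ha hb
  | smul c a _ ha => rw [map_smul]; exact Submodule.smul_mem _ _ ha
  | mem a ha =>
    obtain ⟨p, μ, i, h1, h2, rfl⟩ := ha
    refine Submodule.subset_span ⟨p, μ, m + i, h1, h2, ?_⟩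
    rw [pow_add, Module.End.mul_apply]

/-- `F` is nilpotent, as it lowers the weight by `2` and the weights are at least `-D`. -/
theorem F_pow_eq_zero (x : X D) : rho x (gen .F) ^ (D + 1) = 0 := by
  refine (vert D).ext fun y => ?_
  rw [F_pow_eq_divPow, LinearMap.zero_apply]
  have hy : rho x (gen .H) (vert D y) = ((D : ℂ) - 2 * hammingDist x y) • vert D y := by
    rw [rho_H, dualAdj, Module.Basis.constr_basis]
  have h := H_divPow hy (D + 1)
  rw [rho_H] at h
  by_contra h0
  obtain ⟨j, hj, hw⟩ := exists_weight_eq h (right_ne_zero_of_smul h0)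
  have : (hammingDist x y + (D + 1) : ℕ) = j := by
    have : ((hammingDist x y + (D + 1) : ℕ) : ℂ) = j := by
      push_cast at hw ⊢; linear_combination -hw / 2
    exact_mod_cast this
  omega

/-- `ℂ^X` is generated under `F` by the weight vectors killed by `E`. -/
theorem span_lowered (x : X D) : Submodule.span ℂ (lowered x) = ⊤ := by
  have key : ∀ m : ℕ, ∀ v, ∃ s ∈ Submodule.span ℂ (lowered x), ∃ w,
      v = s + (rho x (gen .F) ^ m) w := by
    intro m v
    induction m with
    | zero => exact ⟨0, Submodule.zero_mem _, v, by simp⟩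
    | succ m ih =>
      obtain ⟨s, hs, w, rfl⟩ := ih
      obtain ⟨k, hk, _, ⟨w', rfl⟩, rfl⟩ := Submodule.mem_sup.1
        ((ker_E_sup_range_F x).symm ▸ Submodule.mem_top : w ∈ _)
      refine ⟨s + (rho x (gen .F) ^ m) k, Submodule.add_mem _ hs
        (F_pow_span_lowered x m (ker_E_le_span_lowered x hk)), w', ?_⟩
      rw [map_add, pow_succ, Module.End.mul_apply, add_assoc]
  rw [eq_top_iff]
  intro v _
  obtain ⟨s, hs, w, rfl⟩ := key (D + 1) v
  rw [F_pow_eq_zero, LinearMap.zero_apply, add_zero]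
  exact hs

/-- A vector `F^i p` with `p` of weight `D - 2j` lies in `ℂ^{X_e}` or in `ℂ^{X ∖ X_e}`, according to
the parity of `i + j`; those in `ℂ^{X_e}` span this space. -/
theorem CXe_le_span_lowered {x : X D} (hx : x ∈ Xe D) :
    CXe D ≤ Submodule.span ℂ (lowered x ∩ CXe D) := by
  have hsplit : lowered x ⊆ (lowered x ∩ CXe D) ∪ (lowered x ∩ CXo D) := by
    rintro w hw
    have hw' := hw
    obtain ⟨p, μ, i, -, h2, rfl⟩ := hw'
    by_cases h0 : p = 0
    · left; exact ⟨hw, by rw [h0, map_zero]; exact Submodule.zero_mem _⟩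
    obtain ⟨j, -, rfl⟩ := exists_weight_eq h2 h0
    have hH := H_divPow (R := rho x) (v := p) (by rw [rho_H]; exact h2) i
    rw [rho_H, show (D : ℂ) - 2 * j - 2 * i = D - 2 * (j + i : ℕ) by push_cast; ring] at hH
    have hF := F_pow_eq_divPow (rho x) p i
    by_cases hji : Even (j + i)
    · left; exact ⟨hw, hF ▸ Submodule.smul_mem _ _ (weight_mem_CXe hx hH hji)⟩
    · right; exact ⟨hw, hF ▸ Submodule.smul_mem _ _ (weight_mem_CXo hx hH hji)⟩
  intro v hv
  have hv' : v ∈ Submodule.span ℂ ((lowered x ∩ CXe D) ∪ (lowered x ∩ CXo D)) :=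
    Submodule.span_mono hsplit (span_lowered x ▸ Submodule.mem_top)
  rw [Submodule.span_union] at hv'
  obtain ⟨a, ha, b, hb, hab⟩ := Submodule.mem_sup.1 hv'
  have ha' : a ∈ CXe D := Submodule.span_le.2 Set.inter_subset_right ha
  have hb' : b ∈ CXo D := Submodule.span_le.2 Set.inter_subset_right hb
  have hb0 : b = 0 := eq_zero_of_mem_CXe_of_mem_CXo (by
    rw [← add_sub_cancel_left a b, hab]; exact Submodule.sub_mem _ hv ha') hb'
  rw [← hab, hb0, add_zero]
  exact ha

/-! ### Existence of primitive vectors -/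

theorem card_sphere (x : X D) (k : ℕ) :
    (Finset.univ.filter fun y => hammingDist x y = k).card = D.choose k := by
  refine Eq.trans ?_ (show (Finset.powersetCard k (Finset.univ : Finset (Fin D))).card = _ by
    rw [Finset.card_powersetCard, Finset.card_fin])
  refine Finset.card_nbij' (fun y => Finset.univ.filter fun i => x i ≠ y i)
    (fun s i => if i ∈ s then 1 - x i else x i) ?_ ?_ ?_ ?_
  · intro y hy
    have hy' : hammingDist x y = k := by simpa using hy
    simpa [Finset.mem_powersetCard, hammingDist] using hy'
  · intro s hs
    have hs' : s.card = k := by simpa [Finset.mem_powersetCard] using hs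
    simp only [Finset.coe_filter, Finset.mem_univ, true_and, Set.mem_ofPred_eq, hammingDist]
    rw [← hs']
    congr 1
    ext i
    by_cases h : i ∈ s
    · simpa [h] using (fin2_ne_iff _ _).2 rfl
    · simp [h]
  · intro y _
    funext i
    by_cases h : x i = y i
    · simp [h]
    · simpa [h] using ((fin2_ne_iff _ _).1 h).symm
  · intro s _
    ext i
    by_cases h : i ∈ s
    · simpa [h] using (fin2_ne_iff _ _).2 rfl
    · simp [h]

theorem finrank_sphere (x : X D) (k : ℕ) :
    Module.finrank ℂ (supp {y | hammingDist x y = k}) = D.choose k := by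
  have hli : LinearIndependent ℂ fun y : {y | hammingDist x y = k} => vert D y :=
    (vert D).linearIndependent.comp _ Subtype.val_injective
  have := finrank_span_eq_card hli
  rw [← card_sphere x k, supp, Set.image_eq_range, this, Fintype.card_subtype]
  rfl

theorem choose_lt_choose_succ {k : ℕ} (h : 2 * (k + 1) ≤ D) : D.choose k < D.choose (k + 1) := by
  have h1 := Nat.choose_succ_right_eq D k
  have h2 : 0 < D.choose k := Nat.choose_pos (by omega)
  have h3 : k + 1 < D - k := by omega
  by_contra! h4
  have h5 : D.choose (k + 1) * (k + 1) ≤ D.choose k * (k + 1) := Nat.mul_le_mul_right _ h4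
  have h6 : D.choose k * (k + 1) < D.choose k * (D - k) := Nat.mul_lt_mul_of_pos_left h3 h2
  omega

/-- For `k ≤ D/2` there is a primitive vector of weight `D - 2k`, as the sphere of radius `k` has
more vertices than the sphere of radius `k - 1`. -/
theorem exists_primitive (x : X D) {k : ℕ} (hk : 2 * k ≤ D) :
    ∃ v : CX D, v ≠ 0 ∧ rho x (gen .E) v = 0 ∧ dualAdj x v = ((D : ℂ) - 2 * k) • v := by
  have hE : ∀ v : CX D, dualAdj x v = ((D : ℂ) - 2 * k) • v →
      dualAdj x (rho x (gen .E) v) = ((D : ℂ) - 2 * k + 2) • rho x (gen .E) v := by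
    intro v hv
    have := rep_HE (rho x) v
    rw [rho_H, hv, map_smul] at this
    rw [this, add_smul]
  cases k with
  | zero =>
    have hw : dualAdj x (vert D x) = ((D : ℂ) - 2 * (0 : ℕ)) • vert D x := by
      rw [dualAdj, Module.Basis.constr_basis, hammingDist_self]
    refine ⟨vert D x, (vert D).ne_zero x, ?_, hw⟩
    by_contra h0
    obtain ⟨j, -, hj⟩ := exists_weight_eq (hE _ hw) h0
    have : ((j + 1 : ℕ) : ℂ) = 0 := by push_cast at hj ⊢; linear_combination hj / 2
    exact Nat.cast_ne_zero.2 j.succ_ne_zero this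
  | succ k =>
    by_contra! hcon
    have hmap : ∀ v ∈ supp {y | hammingDist x y = k + 1},
        rho x (gen .E) v ∈ supp {y | hammingDist x y = k} := fun v hv => by
      have := hE v (supp_weight hv)
      rw [show (D : ℂ) - 2 * (k + 1 : ℕ) + 2 = D - 2 * k by push_cast; ring] at this
      exact weight_mem_supp this
    have hinj : Function.Injective ((rho x (gen .E)).restrict hmap) := by
      rw [injective_iff_map_eq_zero]
      rintro ⟨v, hv⟩ h
      by_contra h0
      exact hcon v (fun e => h0 (Subtype.ext e)) (congrArg Subtype.val h) (supp_weight hv)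
    have := LinearMap.finrank_le_finrank_of_injective hinj
    rw [finrank_sphere, finrank_sphere] at this
    exact absurd (choose_lt_choose_succ hk) (not_lt.2 this)

end Cube

/-! ### Simple modules over products of matrix algebras -/

section Product

variable {A I : Type*} [Ring A] {M : I → Type*} [∀ i, AddCommGroup (M i)]
  [∀ i, Module ℂ (M i)] [∀ i, Module A (M i)] (ψ : A ≃+* ∀ i, Module.End ℂ (M i))

theorem isSimpleModule_of_equiv_pi_end (hψ : ∀ a i m, ψ a i m = a • m) (i : I)
    [Nontrivial (M i)] : IsSimpleModule A (M i) := by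
  classical
  rw [isSimpleModule_iff_toSpanSingleton_surjective]
  refine ⟨inferInstance, fun m hm m' => ?_⟩
  obtain ⟨T, hT⟩ := ((isSimpleModule_iff_toSpanSingleton_surjective (R := Module.End ℂ (M i))
    (M := M i)).1 inferInstance).2 m hm m'
  refine ⟨ψ.symm (Pi.single i T), ?_⟩
  rw [LinearMap.toSpanSingleton_apply, ← hψ, ψ.apply_symm_apply, Pi.single_eq_same]
  exact hT

theorem isEmpty_linearEquiv_of_equiv_pi_end (hψ : ∀ a i m, ψ a i m = a • m) {i j : I}
    (hij : i ≠ j) [Nontrivial (M i)] : IsEmpty (M i ≃ₗ[A] M j) := by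
  classical
  refine ⟨fun e => ?_⟩
  obtain ⟨m, hm⟩ := exists_ne (0 : M i)
  have h1 : ψ.symm (Pi.single i 1) • m = m := by
    rw [← hψ, ψ.apply_symm_apply, Pi.single_eq_same, Module.End.one_apply]
  have h2 : ψ.symm (Pi.single i 1) • e m = 0 := by
    rw [← hψ, ψ.apply_symm_apply, Pi.single_eq_of_ne hij.symm, LinearMap.zero_apply]
  rw [← map_smul, h1] at h2
  exact hm (e.map_eq_zero_iff.1 h2)

/-- A simple module `V` over a finite product of matrix algebras is one of the factors `M i`: some
rank one operator `m ↦ f m • m₀` does not kill `V`, and `m ↦ (f • m) • v` is then a nonzero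
homomorphism from `M i` to `V`. -/
theorem exists_linearEquiv_of_equiv_pi_end [Fintype I] [∀ i, FiniteDimensional ℂ (M i)]
    [∀ i, Nontrivial (M i)] (hψ : ∀ a i m, ψ a i m = a • m) (V : Type*) [AddCommGroup V]
    [Module A V] [IsSimpleModule A V] : ∃ i, Nonempty (V ≃ₗ[A] M i) := by
  classical
  have := IsSimpleModule.nontrivial A V
  obtain ⟨v, hv⟩ := exists_ne (0 : V)
  obtain ⟨i, f, m₀, hne⟩ : ∃ (i : I) (f : M i →ₗ[ℂ] ℂ) (m₀ : M i),
      ψ.symm (Pi.single i (f.smulRight m₀)) • v ≠ 0 := by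
    by_contra! h
    refine hv ?_
    rw [← one_smul A v, ← map_one ψ.symm, ← Finset.univ_sum_single (1 : ∀ i, Module.End ℂ (M i)),
      map_sum, Finset.sum_smul]
    refine Finset.sum_eq_zero fun i _ => ?_
    let b := Module.finBasis ℂ (M i)
    have h1 : (1 : Module.End ℂ (M i)) = ∑ t, (b.coord t).smulRight (b t) := by
      refine LinearMap.ext fun m => ?_
      simp [LinearMap.sum_apply, b.sum_repr]
    have h2 : (Pi.single i (∑ t, (b.coord t).smulRight (b t)) : ∀ i, Module.End ℂ (M i)) =
        ∑ t, Pi.single i ((b.coord t).smulRight (b t)) :=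
      map_sum (AddMonoidHom.single (fun i => Module.End ℂ (M i)) i) _ _
    rw [Pi.one_apply, h1, h2, map_sum, Finset.sum_smul]
    exact Finset.sum_eq_zero fun t _ => h i _ _
  let φ : M i →ₗ[A] V :=
    { toFun := fun m => ψ.symm (Pi.single i (f.smulRight m)) • v
      map_add' := fun a b => by
        rw [← add_smul, ← map_add, ← Pi.single_add]
        congr 4
        ext; simp
      map_smul' := fun a m => by
        rw [RingHom.id_apply, smul_smul]
        congr 1
        apply ψ.injective
        rw [map_mul, ψ.apply_symm_apply, ψ.apply_symm_apply]
        funext j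
        rw [Pi.mul_apply]
        by_cases hj : j = i
        · subst hj
          rw [Pi.single_eq_same, Pi.single_eq_same]
          ext w
          simp [← hψ]
        · rw [Pi.single_eq_of_ne hj, Pi.single_eq_of_ne hj, mul_zero] }
  have := isSimpleModule_of_equiv_pi_end ψ hψ i
  have hφ : φ ≠ 0 := fun h => hne (LinearMap.congr_fun h m₀)
  exact ⟨i, ⟨(LinearEquiv.ofBijective φ (LinearMap.bijective_of_ne_zero hφ)).symm⟩⟩

/-- If `A` is a finite product of the matrix algebras `End (M i)`, then the modules `M i` form a
complete list of simple `A`-modules without repetitions. -/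
theorem exists_modules_of_equiv_pi_end {A I : Type*} [Ring A] [Fintype I] {M : I → Type*}
    [∀ i, AddCommGroup (M i)] [∀ i, Module ℂ (M i)] [∀ i, FiniteDimensional ℂ (M i)]
    [∀ i, Nontrivial (M i)] (ψ : A ≃+* ∀ i, Module.End ℂ (M i)) :
    ∃ _ : ∀ i, Module A (M i), (∀ a i (m : M i), a • m = ψ a i m) ∧
      (∀ i, IsSimpleModule A (M i)) ∧ (∀ i j, i ≠ j → IsEmpty (M i ≃ₗ[A] M j)) ∧
      ∀ (V : Type*) [AddCommGroup V] [Module A V], IsSimpleModule A V →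
        ∃ i, Nonempty (V ≃ₗ[A] M i) := by
  let inst : ∀ i, Module A (M i) := fun i => Module.compHom (M i)
    ((Pi.evalRingHom (fun i => Module.End ℂ (M i)) i).comp ψ.toRingHom)
  have hψ : ∀ a i (m : M i), ψ a i m = a • m := fun _ _ _ => rfl
  exact ⟨inst, fun _ _ _ => rfl, fun i => isSimpleModule_of_equiv_pi_end ψ hψ i,
    fun _ _ hij => isEmpty_linearEquiv_of_equiv_pi_end ψ hψ hij,
    fun V _ _ _ => exists_linearEquiv_of_equiv_pi_end ψ hψ V⟩

end Product

/-! ### The isomorphism of `T_e(x)` with a product of matrix algebras -/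

/-- The indices of all modules in the list. -/
abbrev Idx (D : ℕ) : Type := EvenIdx D ⊕ OddIdx D

/-- The number `k` belonging to an index. -/
def Idx.val {D : ℕ} : Idx D → ℕ
  | .inl k => k.1
  | .inr k => k.1

theorem Idx.val_injective {D : ℕ} : Function.Injective (Idx.val (D := D)) := by
  rintro (⟨j, hj, _⟩ | ⟨j, hj, _⟩) (⟨k, hk, _⟩ | ⟨k, hk, _⟩) h <;>
    simp only [Idx.val] at h <;> subst h
  · rfl
  · exact absurd hj (Nat.not_even_iff_odd.2 hk)
  · exact absurd hk (Nat.not_even_iff_odd.2 hj)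
  · rfl

theorem Idx.two_mul_val_add_le {D : ℕ} (i : Idx D) : 2 * i.val + i.val % 2 ≤ D := by
  rcases i with ⟨j, hj, h⟩ | ⟨j, hj, h⟩ <;> simp only [Idx.val]
  · rw [Nat.even_iff] at hj; omega
  · rw [Nat.odd_iff] at hj; omega

theorem Idx.two_mul_val_le {D : ℕ} (i : Idx D) : 2 * i.val ≤ D :=
  (Nat.le_add_right _ _).trans i.two_mul_val_add_le

instance (D : ℕ) : Finite (EvenIdx D) :=
  Finite.of_injective (fun k => (⟨k.1, by have := k.2.2; omega⟩ : Fin (D / 2 + 1)))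
    fun _ _ h => Subtype.ext (congrArg Fin.val h)

instance (D : ℕ) : Finite (OddIdx D) :=
  Finite.of_injective (fun k => (⟨k.1, by have := k.2.2; omega⟩ : Fin ((D - 1) / 2 + 1)))
    fun _ _ h => Subtype.ext (congrArg Fin.val h)

noncomputable instance (D : ℕ) : Fintype (EvenIdx D) := Fintype.ofFinite _

noncomputable instance (D : ℕ) : Fintype (OddIdx D) := Fintype.ofFinite _

/-- The modules in the list. -/
noncomputable def irr (D : ℕ) : ∀ i : Idx D, Submodule Ue (L (D - 2 * i.val))
  | .inl k => L0 (D - 2 * k.1)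
  | .inr k => L1 (D - 2 * k.1)

/-- Both types of modules in the list are of the form `⨁_{j ∈ ℤ} L_n(n - 2ε - 4j)`, where `ε` is
the parity of `k`. -/
theorem irr_eq {D : ℕ} (i : Idx D) :
    irr D i = wtSum (L (D - 2 * i.val)) (((D - 2 * i.val : ℕ) : ℂ) - 2 * (i.val % 2 : ℕ)) := by
  rcases i with ⟨k, hk, _⟩ | ⟨k, hk, _⟩
  · simp [irr, L0, Idx.val, Nat.even_iff.1 hk]; rfl
  · simp [irr, L1, Idx.val, Nat.odd_iff.1 hk]; rfl

/-- The basis of a module in the list given by its weight vectors. -/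
noncomputable def irrEquiv {D : ℕ} (i : Idx D) :
    irr D i ≃ₗ[ℂ] (Fin ((D - 2 * i.val + 2 - i.val % 2) / 2) → ℂ) :=
  ((LinearEquiv.ofEq _ _ (irr_eq i)).restrictScalars ℂ).trans
    (wtSumEquiv rfl (Nat.mod_lt _ two_pos))

instance {D : ℕ} (i : Idx D) : FiniteDimensional ℂ (irr D i) :=
  Module.Finite.equiv (irrEquiv i).symm

theorem irr_nontrivial {D : ℕ} (i : Idx D) : Nontrivial (irr D i) := by
  have h : 0 < (D - 2 * i.val + 2 - i.val % 2) / 2 := by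
    have := i.two_mul_val_add_le
    omega
  have : Nonempty (Fin ((D - 2 * i.val + 2 - i.val % 2) / 2)) := ⟨⟨0, h⟩⟩
  exact (irrEquiv i).toEquiv.nontrivial

/-- The action of `U(sl₂)_e` on the modules in the list. -/
noncomputable def irrRep (D : ℕ) : Ue →ₐ[ℂ] ∀ i : Idx D, Module.End ℂ (irr D i) :=
  AlgHom.pi fun i => Algebra.lsmul ℂ ℂ (irr D i)

theorem irrRep_apply {D : ℕ} (u : Ue) (i : Idx D) (w : irr D i) : irrRep D u i w = u • w := rfl

/-- The even subalgebra acts on each module in the list through all of its linear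
endomorphisms. -/
theorem exists_smul_eq_irr_end {D : ℕ} (i : Idx D) (T : Module.End ℂ (irr D i)) :
    ∃ u : Ue, ∀ w, u • w = T w := by
  revert T
  rw [irr_eq i]
  exact exists_smul_eq_end rfl (Nat.mod_lt _ two_pos)

/-- The Casimir element acts on the modules in the list by different scalars, so that polynomials in
it project to each of them. -/
theorem irrRep_surjective (D : ℕ) : Function.Surjective (irrRep D) := by
  classical
  intro T
  have hp : ∀ i : Idx D, ∃ p : Polynomial ℂ, ∀ j : Idx D,
      p.eval (((D - 2 * j.val : ℕ) : ℂ) ^ 2 + 2 * (D - 2 * j.val : ℕ)) =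
        if j = i then 1 else 0 := by
    intro i
    refine (Polynomial.exists_eval_eq_iff _ _).2 fun j k hjk => ?_
    have h1 : (D - 2 * j.val) ^ 2 + 2 * (D - 2 * j.val) =
        (D - 2 * k.val) ^ 2 + 2 * (D - 2 * k.val) := by exact_mod_cast hjk
    have h2 : D - 2 * j.val = D - 2 * k.val := by nlinarith
    have h3 : j = k := Idx.val_injective (by
      have := j.two_mul_val_le; have := k.two_mul_val_le; omega)
    rw [h3]
  choose p hp using hp
  choose u hu using fun i => exists_smul_eq_irr_end i (T i)
  refine ⟨∑ i, u i * Polynomial.aeval casimir (p i), ?_⟩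
  funext j
  refine LinearMap.ext fun w => ?_
  have hC : casimir • w = (((D - 2 * j.val : ℕ) : ℂ) ^ 2 + 2 * (D - 2 * j.val : ℕ)) • w :=
    Subtype.ext (casimir_smul _ _)
  rw [irrRep_apply, Finset.sum_smul, Finset.sum_eq_single j]
  · rw [mul_smul, aeval_smul_of_smul_eq hC, hp, if_pos rfl, one_smul, hu]
  · intro i _ hij
    rw [mul_smul, aeval_smul_of_smul_eq hC, hp, if_neg hij.symm, zero_smul, smul_zero]
  · simp

/-- An element of `U(sl₂)_e` acting as zero on all modules in the list acts as zero on
`ℂ^{X_e}`. -/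
theorem toTe_eq_zero_of_irrRep {D : ℕ} {x : X D} (hx : x ∈ Xe D) {u : Ue}
    (hu : irrRep D u = 0) : toTe x u = 0 := by
  suffices h : ∀ v ∈ CXe D, rho x u v = 0 from
    Subtype.ext (LinearMap.ext fun v => Subtype.ext (h v v.2))
  intro v hv
  have hv' := CXe_le_span_lowered hx hv
  clear hv
  induction hv' using Submodule.span_induction with
  | zero => rw [map_zero]
  | add a b _ _ ha hb => rw [map_add, ha, hb, add_zero]
  | smul c a _ ha => rw [map_smul, ha, smul_zero]
  | mem w hw =>
    obtain ⟨⟨p, μ, i, hE, hH, rfl⟩, hw⟩ := hw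
    rw [F_pow_eq_divPow, map_smul]
    by_cases hp : divPow (rho x) p i = 0
    · rw [hp, map_zero, smul_zero]
    have hp0 : p ≠ 0 := fun h => hp (by rw [h, divPow, map_zero, smul_zero])
    obtain ⟨k, -, rfl⟩ := exists_weight_eq hH hp0
    have hH' : rho x (gen .H) p = ((D : ℂ) - 2 * k) • p := by rw [rho_H]; exact hH
    obtain ⟨n, hn, φ, -, hφ, hcomm⟩ := exists_embedding_of_primitive hp0 hE hH'
    have hn' : D = n + 2 * k := by
      have : (D : ℂ) = ((n + 2 * k : ℕ) : ℂ) := by push_cast; rw [← hn]; ring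
      exact_mod_cast this
    obtain rfl : n = D - 2 * k := by omega
    have hi : i ≤ D - 2 * k := by
      by_contra hi
      exact hp (by rw [← hφ, L.v_of_gt (not_le.1 hi), map_zero])
    have hki : Even (k + i) := by
      by_contra hki
      have hHi := H_divPow hH' i
      rw [rho_H, show (D : ℂ) - 2 * k - 2 * i = D - 2 * (k + i : ℕ) by push_cast; ring] at hHi
      have hF := F_pow_eq_divPow (rho x) p i
      have := eq_zero_of_mem_CXe_of_mem_CXo hw (by
        rw [hF]; exact Submodule.smul_mem _ _ (weight_mem_CXo hx hHi hki))
      rw [hF, smul_eq_zero] at this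
      exact this.elim (fun h => i.factorial_ne_zero (by exact_mod_cast h)) hp
    -- if `k` is odd then so is `i`, hence `D - 2k ≥ i ≥ 1` and `k ≤ (D - 1) / 2`
    obtain ⟨j, hj⟩ : ∃ j : Idx D, j.val = k := by
      rcases Nat.even_or_odd k with h | h
      · exact ⟨.inl ⟨k, h, by omega⟩, rfl⟩
      · refine ⟨.inr ⟨k, h, ?_⟩, rfl⟩
        rw [Nat.even_iff] at hki
        rw [Nat.odd_iff] at h
        omega
    subst hj
    have hmem : L.v (D - 2 * j.val) i ∈ irr D j := by
      rw [irr_eq]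
      have := v_mem_wtSum (n := D - 2 * j.val) (ε := j.val % 2) rfl (i / 2)
      rwa [show 2 * (i / 2) + j.val % 2 = i by rw [Nat.even_iff] at hki; omega] at this
    have hz : u • L.v (D - 2 * j.val) i = 0 :=
      congrArg Subtype.val (LinearMap.congr_fun (congrFun hu j) ⟨_, hmem⟩)
    rw [← hφ, ← hcomm]
    change _ • φ (u • L.v (D - 2 * j.val) i) = 0
    rw [hz, map_zero, smul_zero]

/-- An element of `U(sl₂)_e` acting as zero on `ℂ^{X_e}` acts as zero on all modules in the list,
as they embed into `ℂ^{X_e}`. -/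
theorem irrRep_eq_zero_of_toTe {D : ℕ} {x : X D} (hx : x ∈ Xe D) {u : Ue}
    (hu : toTe x u = 0) : irrRep D u = 0 := by
  have hu' : ∀ v ∈ CXe D, rho x u v = 0 := fun v hv =>
    congrArg Subtype.val (LinearMap.congr_fun (congrArg Subtype.val hu) ⟨v, hv⟩)
  funext j
  refine LinearMap.ext fun w => Subtype.ext ?_
  change u • (w : L (D - 2 * j.val)) = 0
  obtain ⟨p, hp0, hE, hH⟩ := exists_primitive x j.two_mul_val_le
  have hH' : rho x (gen .H) p = ((D : ℂ) - 2 * j.val) • p := by rw [rho_H]; exact hH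
  obtain ⟨n, hn, φ, hinj, hφ, hcomm⟩ := exists_embedding_of_primitive hp0 hE hH'
  have hn' : D = n + 2 * j.val := by
    have : (D : ℂ) = ((n + 2 * j.val : ℕ) : ℂ) := by push_cast; rw [← hn]; ring
    exact_mod_cast this
  obtain rfl : n = D - 2 * j.val := by omega
  have hmem : φ w ∈ CXe D := by
    have hw : (w : L (D - 2 * j.val)) =
        ∑ t, irrEquiv j w t • L.v (D - 2 * j.val) (2 * t + j.val % 2) :=
      congrArg Subtype.val ((irrEquiv j).symm_apply_apply w).symm
    rw [hw, map_sum]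
    refine Submodule.sum_mem _ fun t _ => ?_
    rw [map_smul, hφ]
    refine Submodule.smul_mem _ _ (weight_mem_CXe (x := x) hx
      (j := j.val + (2 * t + j.val % 2)) ?_ (by rw [Nat.even_iff]; omega))
    rw [← rho_H, H_divPow hH']
    congr 1; push_cast; ring
  apply hinj
  rw [map_zero, ← hu' _ hmem]
  exact hcomm u (w : L (D - 2 * j.val))

/-- `T_e(x)` is isomorphic to the product of the endomorphism algebras of the modules in the list,
as both are quotients of `U(sl₂)_e` by the same ideal. -/
theorem exists_algEquiv_irr {D : ℕ} {x : X D} (hx : x ∈ Xe D) :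
    ∃ ψ : Te x ≃ₐ[ℂ] ∀ i : Idx D, Module.End ℂ (irr D i), ∀ u, ψ (toTe x u) = irrRep D u := by
  have hker : RingHom.ker (toTe x) = RingHom.ker (irrRep D) := by
    ext u
    exact ⟨fun h => irrRep_eq_zero_of_toTe hx h, fun h => toTe_eq_zero_of_irrRep hx h⟩
  refine ⟨(Ideal.quotientKerAlgEquivOfSurjective (toTe_surjective x)).symm.trans
    ((Ideal.quotientEquivAlgOfEq ℂ hker).trans
      (Ideal.quotientKerAlgEquivOfSurjective (irrRep_surjective D))), fun u => ?_⟩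
  rw [AlgEquiv.trans_apply, Ideal.quotientKerAlgEquivOfSurjective_symm_apply]
  rfl

/-! ### The Wedderburn decomposition and the dimension -/

theorem two_mul_choose_two (n : ℕ) : 2 * (n + 1).choose 2 = (n + 1) * n := by
  induction n with
  | zero => rfl
  | succ n ih =>
    rw [Nat.choose_succ_succ' (n + 1) 1, Nat.choose_one_right, mul_add, ih]
    ring

theorem choose_three_add_two (n : ℕ) : (n + 3).choose 3 = (n + 1).choose 3 + (n + 1) ^ 2 := by
  have h := two_mul_choose_two n
  rw [Nat.choose_succ_succ' (n + 2) 2, Nat.choose_succ_succ' (n + 1) 2,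
    Nat.choose_succ_succ' (n + 1) 1, Nat.choose_one_right]
  linarith

theorem sum_even_sq (m : ℕ) :
    ∑ k ∈ Finset.range (m + 1) with Even k, (m - k + 1) ^ 2 = (m + 3).choose 3 := by
  induction m using Nat.twoStepInduction with
  | zero => rfl
  | one => rfl
  | more m ih _ =>
    rw [choose_three_add_two (m + 2), ← ih, Finset.sum_filter, Finset.sum_range_succ',
      Finset.sum_range_succ', Finset.sum_filter]
    simp [Nat.even_add, Nat.add_sub_add_right]

theorem sum_odd_sq (m : ℕ) :
    ∑ k ∈ Finset.range (m + 1) with Odd k, (m - k + 1) ^ 2 = (m + 2).choose 3 := by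
  induction m using Nat.twoStepInduction with
  | zero => rfl
  | one => rfl
  | more m ih _ =>
    rw [choose_three_add_two (m + 1), ← ih, Finset.sum_filter, Finset.sum_range_succ',
      Finset.sum_range_succ', Finset.sum_filter]
    simp [Nat.odd_add, Nat.add_sub_add_right]

/-- A product of algebras indexed by a sum type is the product of the two partial products. -/
def algEquivSumPi {I J : Type*} (R : I ⊕ J → Type*) [∀ i, Ring (R i)] [∀ i, Algebra ℂ (R i)] :
    (∀ i, R i) ≃ₐ[ℂ] (∀ i, R (.inl i)) × (∀ j, R (.inr j)) :=
  { Equiv.sumPiEquivProdPi R with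
    map_mul' := fun _ _ => rfl
    map_add' := fun _ _ => rfl
    commutes' := fun _ => rfl }

/-- The module with index `k` has dimension `⌊D/2⌋ - k + 1` for even `k` and `⌊(D-1)/2⌋ - k + 1` for
odd `k`. -/
theorem nonempty_algEquiv_matrix {D : ℕ} {x : X D} (hx : x ∈ Xe D) :
    Nonempty (Te x ≃ₐ[ℂ]
      ((∀ k : EvenIdx D, Module.End ℂ (Fin (D / 2 - k.1 + 1) → ℂ)) ×
        (∀ k : OddIdx D, Module.End ℂ (Fin ((D - 1) / 2 - k.1 + 1) → ℂ)))) := by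
  obtain ⟨ψ, -⟩ := exists_algEquiv_irr hx
  have he : ∀ k : EvenIdx D,
      (D - 2 * k.1 + 2 - k.1 % 2) / 2 = D / 2 - k.1 + 1 := by
    rintro ⟨k, hk, h⟩
    rw [Nat.even_iff] at hk
    simp only
    omega
  have ho : ∀ k : OddIdx D,
      (D - 2 * k.1 + 2 - k.1 % 2) / 2 = (D - 1) / 2 - k.1 + 1 := by
    rintro ⟨k, hk, h⟩
    rw [Nat.odd_iff] at hk
    simp only
    omega
  refine ⟨(ψ.trans (algEquivSumPi fun i => Module.End ℂ (irr D i))).trans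
    (AlgEquiv.prodCongr (AlgEquiv.piCongrRight fun k => ?_) (AlgEquiv.piCongrRight fun k => ?_))⟩
  · exact ((irrEquiv (.inl k)).trans
      (LinearEquiv.funCongrLeft ℂ ℂ (finCongr (he k).symm))).conjAlgEquiv ℂ
  · exact ((irrEquiv (.inr k)).trans
      (LinearEquiv.funCongrLeft ℂ ℂ (finCongr (ho k).symm))).conjAlgEquiv ℂ

theorem finrank_Te {D : ℕ} (hD : 2 ≤ D) {x : X D} (hx : x ∈ Xe D) :
    Module.finrank ℂ (Te x) = (D / 2 + 3).choose 3 + ((D + 1) / 2 + 1).choose 3 := by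
  obtain ⟨e⟩ := nonempty_algEquiv_matrix hx
  have h1 : ∑ k : EvenIdx D, (D / 2 - k.1 + 1) ^ 2 = (D / 2 + 3).choose 3 := by
    rw [← sum_even_sq]
    exact (Finset.sum_subtype (p := fun k => Even k ∧ k ≤ D / 2)
      ((Finset.range (D / 2 + 1)).filter fun k => Even k)
      (fun k => by simp [and_comm])
      fun k => (D / 2 - k + 1) ^ 2).symm
  have h2 : ∑ k : OddIdx D, ((D - 1) / 2 - k.1 + 1) ^ 2 = ((D + 1) / 2 + 1).choose 3 := by
    rw [show (D + 1) / 2 + 1 = (D - 1) / 2 + 2 by omega, ← sum_odd_sq]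
    exact (Finset.sum_subtype (p := fun k => Odd k ∧ k ≤ (D - 1) / 2)
      ((Finset.range ((D - 1) / 2 + 1)).filter fun k => Odd k)
      (fun k => by simp [and_comm])
      fun k => ((D - 1) / 2 - k + 1) ^ 2).symm
  rw [e.toLinearEquiv.finrank_eq, Module.finrank_prod, Module.finrank_pi_fintype,
    Module.finrank_pi_fintype, ← h1, ← h2]
  simp only [Module.finrank_linearMap, Module.finrank_fin_fun, pow_two]

end HalvedCube

theorem corollary6p6 (D : ℕ) (hD : 2 ≤ D) (x : X D) (hx : x ∈ Xe D) :
    -- (i) there are `T_e(x)`-module structures on the listed spaces which induce the given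
    -- `U(sl₂)_e`-module structures (they are unique, as `toTe x` is onto)
    (∃ (_ : ∀ k : EvenIdx D, Module (Te x) (L0 (D - 2 * k.1)))
      (_ : ∀ k : OddIdx D, Module (Te x) (L1 (D - 2 * k.1))),
      (∀ k : EvenIdx D, Induces x (L0 (D - 2 * k.1))) ∧
      (∀ k : OddIdx D, Induces x (L1 (D - 2 * k.1))) ∧
      -- they are irreducible
      (∀ k : EvenIdx D, IsSimpleModule (Te x) (L0 (D - 2 * k.1))) ∧
      (∀ k : OddIdx D, IsSimpleModule (Te x) (L1 (D - 2 * k.1))) ∧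
      -- they are mutually non-isomorphic
      (∀ j k : EvenIdx D, j ≠ k →
        IsEmpty (L0 (D - 2 * j.1) ≃ₗ[Te x] L0 (D - 2 * k.1))) ∧
      (∀ j k : OddIdx D, j ≠ k →
        IsEmpty (L1 (D - 2 * j.1) ≃ₗ[Te x] L1 (D - 2 * k.1))) ∧
      (∀ (j : EvenIdx D) (k : OddIdx D),
        IsEmpty (L0 (D - 2 * j.1) ≃ₗ[Te x] L1 (D - 2 * k.1))) ∧
      -- every irreducible `T_e(x)`-module is isomorphic to one of them
      (∀ (V : Type*) [AddCommGroup V] [Module (Te x) V],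
        IsSimpleModule (Te x) V →
        (∃ k : EvenIdx D, Nonempty (V ≃ₗ[Te x] L0 (D - 2 * k.1))) ∨
        (∃ k : OddIdx D, Nonempty (V ≃ₗ[Te x] L1 (D - 2 * k.1))))) ∧
    -- (ii) the Wedderburn decomposition
    Nonempty (Te x ≃ₐ[ℂ]
      ((∀ k : EvenIdx D, Module.End ℂ (Fin (D / 2 - k.1 + 1) → ℂ)) ×
        (∀ k : OddIdx D, Module.End ℂ (Fin ((D - 1) / 2 - k.1 + 1) → ℂ)))) ∧
    -- (iii) the dimension; `(D + 1) / 2` is `⌈D/2⌉`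
    Module.finrank ℂ (Te x) =
      (D / 2 + 3).choose 3 + ((D + 1) / 2 + 1).choose 3 := by
  refine ⟨?_, nonempty_algEquiv_matrix hx, finrank_Te hD hx⟩
  obtain ⟨ψ, hψ⟩ := exists_algEquiv_irr hx
  have := fun i : Idx D => irr_nontrivial i
  obtain ⟨inst, hsmul, hsimple, hne, hV⟩ := exists_modules_of_equiv_pi_end
    (A := Te x) (M := fun i => irr D i) (ψ : Te x ≃+* ∀ i, Module.End ℂ (irr D i))
  have hind : ∀ i : Idx D, Induces x (irr D i) := fun i u w =>
    (hsmul (toTe x u) i w).trans (LinearMap.congr_fun (congrFun (hψ u) i) w)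
  refine ⟨fun k => inst (.inl k), fun k => inst (.inr k), fun k => hind (.inl k),
    fun k => hind (.inr k), fun k => hsimple (.inl k), fun k => hsimple (.inr k),
    fun j k hjk => hne (.inl j) (.inl k) fun h => hjk (Sum.inl.inj h),
    fun j k hjk => hne (.inr j) (.inr k) fun h => hjk (Sum.inr.inj h),
    fun j k => hne (.inl j) (.inr k) Sum.inl_ne_inr, fun V _ _ hS => ?_⟩
  obtain ⟨i | i, h⟩ := hV V hS
  · exact .inl ⟨i, h⟩
  · exact .inr ⟨i, h⟩
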